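/- Let $q\in\mathbb{C}$ with $0<|q|<1$, and write $(a)_\infty=\prod_{i\ge 0}(1-aq^i)$, $(a)_n=\prod_{i=0}^{n-1}(1-aq^i)$ for $n\in\mathbb{Z}_{\ge0}$, and $\Delta(y)=\prod_{1\le i<j\le M}(y_i-y_j)$. For $l\in\mathbb{Z}_{\ge 0}^M$ put $|l|=l_1+\cdots+l_M$. Let $A,C,B_1,\dots,B_M\in\mathbb{C}$ with all $B_i\neq0$, and put $B=B_1B_2\cdots B_M$. The $q$-Appell--Lauricella system for a function $z=z(x_1,\dots,x_M)$ is $$[x_i(1-T_{x_j})(1-B_iT_{x_i})-x_j(1-T_{x_i})(1-B_jT_{x_j})]z=0\qquad(1\le i,j\le M),$$ $$[(1-T_{x_i})(1-Cq^{-1}T_{x_1}\cdots T_{x_M})-x_i(1-B_iT_{x_i})(1-AT_{x_1}\cdots T_{x_M})]z=0\qquad(1\le i\le M),$$ where $T_{x_i}$ replaces $x_i$ by $qx_i$. Consider the three functions $$z_1=\prod_{i=1}^M\frac{(Ax_i)_\infty(B_ix_i)_\infty}{(AB_ix_i)_\infty(x_i)_\infty}\sum_{l\in\mathbb{Z}_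{\ge0}^M}q^{\binom{|l|}{2}}\frac{\Delta(\{B_ix_iq^{l_i}\})}{\Delta(\{B_ix_i\})}\frac{(A)_{|l|}}{(C)_{|l|}}\prod_{i=1}^M\left(\frac{1-AB_ix_iq^{|l|+l_i}/q}{1-AB_ix_i/q}\cdot\frac{(AB_ix_i/q)_{|l|}\prod_{j=1}^M(B_ix_i/x_j)_{l_i}\cdot(AB_ix_i/C)_{l_i}(B_iCx_i/B)^{l_i}q^{\binom{l_i}{2}}}{(Ax_i)_{|l|}\prod_{j=1}^M(qB_ix_i/(B_jx_j))_{l_i}\cdot(B_ix_i)_{l_i}}\right),$$ $$z_2=\prod_{i=1}^M\frac{(B_ix_i)_\infty}{(x_i)_\infty}\sum_{l\in\mathbb{Z}_{\ge0}^M}\left(\frac CB\right)^{|l|}\frac{\Delta(\{B_ix_iq^{l_i}\})}{\Delta(\{B_ix_i\})}\prod_{i=1}^M\frac{\prod_{j=1}^M(B_ix_i/x_j)_{l_i}\cdot(AB_ix_i/C)_{l_i}}{\prod_{j=1}^M(qB_ix_i/(B_jx_j))_{l_i}\cdot(B_ix_i)_{l_i}},$$ $$z_3=\prod_{i=1}^M\frac{(B_ix_i)_\infty}{(x_i)_\infty}\sum_{l\in\mathbb{Z}_{\ge0}^M}\left(-\frac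 AB\right)^{|l|}\frac{\Delta(\{B_ix_iq^{l_i}\})}{\Delta(\{B_ix_i\})}\frac{(C/A)_{|l|}}{(C)_{|l|}}\prod_{i=1}^M\frac{\prod_{j=1}^M(B_ix_i/x_j)_{l_i}\cdot(B_ix_i)^{l_i}q^{\binom{l_i}{2}}}{\prod_{j=1}^M(qB_ix_i/(B_jx_j))_{l_i}\cdot(B_ix_i)_{l_i}}.$$ Let $D$ be the set of all $x\in(\mathbb{C}\setminus\{0\})^M$ such that $x_iq^n\ne1$ and $B_ix_iq^n\neq1$ for all $i$ and all integers $n\ge0$, and $B_ix_iq^n\ne B_jx_j$ for all $i\neq j$ and all integers $n\ge0$; let $D_1$ be the set of all $x\in D$ such that moreover $Ax_iq^n\ne1$ and $AB_ix_iq^n\neq q$ for all $i$ and all $n\ge0$. (On these sets, which are stable under all $T_{x_i}$, the denominators depending on $x$ do not vanish.) Then: 1. If $C\ne0$ and $Cq^n\neq1$ for all $n\ge0$, the series in $z_1$ converges absolutely on $D_1$, and $z_1$ is a solution of the $q$-Appell--Lauricella system on $D_1$. 2. If $C\neq0$ and $|C/B|<1$, the series in $z_2$ converges absolutely on $D$,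 and $z_2$ is a solution of the $q$-Appell--Lauricella system on $D$. 3. If $A\ne0$ and $Cq^n\neq1$ for all $n\ge0$, the series in $z_3$ converges absolutely on $D$, and $z_3$ is a solution of the $q$-Appell--Lauricella system on $D$. -/

import Mathlib

open scoped BigOperators

namespace QAppellLauricella

noncomputable section

/-! ### `q`-shifted factorials -/

/-- `(a)_∞ = ∏_{i ≥ 0} (1 - a q^i)`. -/
def qInf (q a : ℂ) : ℂ := ∏' i : ℕ, (1 - a * q ^ i)

/-- `(a)_l = ∏_{0 ≤ i < l} (1 - a q^i)` for `l ∈ ℕ`, i.e. `(a)_∞ / (a q^l)_∞` whenever the latter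
quotient has a nonzero denominator. -/
def qPoch (q a : ℂ) (l : ℕ) : ℂ := ∏ i ∈ Finset.range l, (1 - a * q ^ i)

/-- The infinite product defining `(a)_∞` converges for `|q| < 1`. -/
theorem multipliable_qInf {q : ℂ} (hq : ‖q‖ < 1) (a : ℂ) :
    Multipliable fun i : ℕ => 1 - a * q ^ i := by
  have h : Summable fun i : ℕ => ‖-(a * q ^ i)‖ := by
    simpa [norm_mul, norm_pow] using
      (summable_geometric_of_lt_one (norm_nonneg q) hq).mul_left ‖a‖
  simpa [sub_eq_add_neg] using multipliable_one_add_of_summable h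

/-- `Δ(y) = ∏_{i < j} (y_i - y_j)`. -/
def vdm {M : ℕ} (y : Fin M → ℂ) : ℂ := ∏ i, ∏ j ∈ Finset.Ioi i, (y i - y j)

/-! ### The `q`-Appell--Lauricella system -/

/-- Linear operators on functions of `x = (x_1, …, x_M)`; the product is composition. -/
abbrev Op (M : ℕ) := Module.End ℂ ((Fin M → ℂ) → ℂ)

/-- The `q`-shift operator `T_{x_i}`: `(T_{x_i} z)(x) = z(x_1, …, q x_i, …, x_M)`. -/
def qShift {M : ℕ} (q : ℂ) (i : Fin M) : Op M :=
  LinearMap.funLeft ℂ ℂ fun x => Function.update x i (q * x i)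

/-- The operator `T_{x_1} ⋯ T_{x_M}`. -/
def qShiftAll {M : ℕ} (q : ℂ) : Op M :=
  (List.ofFn fun i : Fin M => qShift q i).prod

theorem qShift_apply {M : ℕ} (q : ℂ) (i : Fin M) (z : (Fin M → ℂ) → ℂ) (x : Fin M → ℂ) :
    qShift q i z x = z (Function.update x i (q * x i)) := rfl

/-- The composite of the shifts in a list of distinct variables. -/
theorem list_prod_qShift_apply {M : ℕ} (q : ℂ) (L : List (Fin M)) (hL : L.Nodup)
    (z : (Fin M → ℂ) → ℂ) (x : Fin M → ℂ) :
    (L.map fun i => qShift q i).prod z x = z fun i => if i ∈ L then q * x i else x i := by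
  induction L generalizing x with
  | nil => simp
  | cons a L ih =>
    rw [List.nodup_cons] at hL
    rw [List.map_cons, List.prod_cons, Module.End.mul_apply, qShift_apply, ih hL.2]
    congr 1
    funext i
    by_cases h : i = a
    · subst h
      simp [hL.1]
    · simp [h]

/-- `(T_{x_1} ⋯ T_{x_M} z)(x) = z(q x_1, …, q x_M)`. -/
theorem qShiftAll_apply {M : ℕ} (q : ℂ) (z : (Fin M → ℂ) → ℂ) (x : Fin M → ℂ) :
    qShiftAll q z x = z fun i => q * x i := by
  have h := list_prod_qShift_apply q (List.finRange M) (List.nodup_finRange M) z x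
  simpa [qShiftAll, List.ofFn_eq_map] using h

/-- `z` is a solution, at all points of `D`, of the `q`-Appell--Lauricella system with parameters
`A`, `B_1, …, B_M`, `C`.  (The sets `D` used below are stable under every `x_i ↦ q x_i`.) -/
def IsSolutionOn {M : ℕ} (q A : ℂ) (B : Fin M → ℂ) (C : ℂ) (D : Set (Fin M → ℂ))
    (z : (Fin M → ℂ) → ℂ) : Prop :=
  ∀ x ∈ D,
    (∀ i j : Fin M,
      x i * ((1 - qShift q j) * (1 - B i • qShift q i) : Op M) z x
        - x j * ((1 - qShift q i) * (1 - B j • qShift q j) : Op M) z x = 0) ∧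
    (∀ i : Fin M,
      ((1 - qShift q i) * (1 - (C * q⁻¹) • qShiftAll q) : Op M) z x
        - x i * ((1 - B i • qShift q i) * (1 - A • qShiftAll q) : Op M) z x = 0)

/-! ### The three multiple series -/

/-- Summand, indexed by `l ∈ ℕ^M`, of the first series. -/
def term1 {M : ℕ} (q A : ℂ) (B : Fin M → ℂ) (C : ℂ) (x : Fin M → ℂ) (l : Fin M → ℕ) : ℂ :=
  q ^ (∑ i, l i).choose 2
    * (vdm (fun i => B i * x i * q ^ l i) / vdm (fun i => B i * x i))
    * (qPoch q A (∑ i, l i) / qPoch q C (∑ i, l i))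
    * ∏ i, ((1 - A * B i * x i * q ^ ((∑ k, l k) + l i) / q) / (1 - A * B i * x i / q)
        * ((qPoch q (A * B i * x i / q) (∑ k, l k)
              * (∏ j, qPoch q (B i * x i / x j) (l i))
              * qPoch q (A * B i * x i / C) (l i)
              * (B i * C * x i / ∏ j, B j) ^ l i * q ^ (l i).choose 2)
            / (qPoch q (A * x i) (∑ k, l k)
              * (∏ j, qPoch q (q * (B i * x i) / (B j * x j)) (l i))
              * qPoch q (B i * x i) (l i))))

def solution1 {M : ℕ} (q A : ℂ) (B : Fin M → ℂ) (C : ℂ) (x : Fin M → ℂ) : ℂ :=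
  (∏ i, qInf q (A * x i) * qInf q (B i * x i) / (qInf q (A * B i * x i) * qInf q (x i)))
    * ∑' l : Fin M → ℕ, term1 q A B C x l

/-- Summand, indexed by `l ∈ ℕ^M`, of the second series. -/
def term2 {M : ℕ} (q A : ℂ) (B : Fin M → ℂ) (C : ℂ) (x : Fin M → ℂ) (l : Fin M → ℕ) : ℂ :=
  (C / ∏ j, B j) ^ (∑ i, l i)
    * (vdm (fun i => B i * x i * q ^ l i) / vdm (fun i => B i * x i))
    * ∏ i, (((∏ j, qPoch q (B i * x i / x j) (l i)) * qPoch q (A * B i * x i / C) (l i))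
        / ((∏ j, qPoch q (q * (B i * x i) / (B j * x j)) (l i)) * qPoch q (B i * x i) (l i)))

def solution2 {M : ℕ} (q A : ℂ) (B : Fin M → ℂ) (C : ℂ) (x : Fin M → ℂ) : ℂ :=
  (∏ i, qInf q (B i * x i) / qInf q (x i)) * ∑' l : Fin M → ℕ, term2 q A B C x l

/-- Summand, indexed by `l ∈ ℕ^M`, of the third series. -/
def term3 {M : ℕ} (q A : ℂ) (B : Fin M → ℂ) (C : ℂ) (x : Fin M → ℂ) (l : Fin M → ℕ) : ℂ :=
  (-(A / ∏ j, B j)) ^ (∑ i, l i)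
    * (vdm (fun i => B i * x i * q ^ l i) / vdm (fun i => B i * x i))
    * (qPoch q (C / A) (∑ i, l i) / qPoch q C (∑ i, l i))
    * ∏ i, (((∏ j, qPoch q (B i * x i / x j) (l i)) * (B i * x i) ^ l i * q ^ (l i).choose 2)
        / ((∏ j, qPoch q (q * (B i * x i) / (B j * x j)) (l i)) * qPoch q (B i * x i) (l i)))

def solution3 {M : ℕ} (q A : ℂ) (B : Fin M → ℂ) (C : ℂ) (x : Fin M → ℂ) : ℂ :=
  (∏ i, qInf q (B i * x i) / qInf q (x i)) * ∑' l : Fin M → ℕ, term3 q A B C x l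

/-! ### Points at which no denominator vanishes -/

/-- The points `x` at which none of the denominators `x_j`, `(x_i)_∞`, `(B_i x_i)_n`,
`Δ(B_1 x_1, …, B_M x_M)`, `(q B_i x_i / (B_j x_j))_n` vanishes.  (For `i ≠ j` and `n = 0` the last
condition says that `Δ` does not vanish; for `n ≥ 1` it is the one on `(q B_i x_i / (B_j x_j))_n`.) -/
def regularSet {M : ℕ} (q : ℂ) (B : Fin M → ℂ) : Set (Fin M → ℂ) :=
  {x | (∀ i, x i ≠ 0) ∧ (∀ i, ∀ n : ℕ, x i * q ^ n ≠ 1) ∧ (∀ i, ∀ n : ℕ, B i * x i * q ^ n ≠ 1) ∧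
    (∀ i j, i ≠ j → ∀ n : ℕ, B i * x i * q ^ n ≠ B j * x j)}

/-- The points of `regularSet q B` at which in addition the denominators `(A x_i)_n`,
`1 - A B_i x_i / q` and `(A B_i x_i)_∞` of the first function do not vanish. -/
def regularSet1 {M : ℕ} (q A : ℂ) (B : Fin M → ℂ) : Set (Fin M → ℂ) :=
  {x | x ∈ regularSet q B ∧ (∀ i, ∀ n : ℕ, A * x i * q ^ n ≠ 1) ∧
    (∀ i, ∀ n : ℕ, A * B i * x i * q ^ n ≠ q)}

end

end QAppellLauricella

/-! Let W(x) = ∏ (B_i x_i)_∞ / (x_i)_∞ and W_n = W(q^n x). The function W satisfies (1 - T_i) W =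
x_i (1 - B_i T_i) W in each variable, so (1 - T_i) W_n = q^n x_i (1 - B_i T_i) W_n. Multiplied by
q^n, both halves of the first equation of the system applied to W_n become (1 - T_i)(1 - T_j) W_n.
Hence every W_n, and every convergent linear combination of the W_n with constant coefficients,
solves the first family of equations.

For the second family, T_1 ⋯ T_M acts on the sequence (W_n) as the shift S. Put D_N = ∏_{i<N} (S -
q^i) / (q)_N, which is up to a nonzero factor the divided difference at N + 1 consecutive powers of
q. If c_{N+1} (1 - C q^N) = c_N (A - C q^N), the second equation applied to ∑ c_N D_N W (0)
telescopes (`sum_second_equation`), and the boundary term is controlled by the general term of a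
convergent series. So every convergent Newton series with such coefficients is a solution
(`isSolutionOn_of_hasSum`). It remains to show that the three given functions are Newton series of
this kind.

The bridge is a sum of Milne type over |l| = N with two free parameters β, γ. Two partial fraction
identities give a recurrence in N relating the points X and qX (`milneSum_succ`), and `milneSum_eq`
solves it in terms of D_k applied to F(n) = ∏ (X_i/a_i)_n / (X_i)_n. With a = B and X = Bx one has
W_n = W_0 F(n).

Third series: for (β, γ) = (0, 1) the sum is a single D_N F (0), which gives c_N = ∏_{i<N} (A - C
q^i) / (C)_N. Second series: for (β, γ) = (1, A/C) there is a double sum, and the inner sum is a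
q-binomial series whose functional equation supplies the factor 1 - C q^N.

First series: the (0, 1) evaluation is used in M + 1 variables, the extra ones being X_0 = q/(A q^N)
and a_0 = q/(C q^N). On the analytic side the q-Leibniz rule splits off the extra variable. The
resulting finite identity holds for generic A, extends to the other admissible A by continuity, and
as N → ∞ yields the same c_N as the third series (`hasSum_term1`). -/

namespace QAppellLauricella

/-! ### Newton divided differences at the nodes `1, q, q², …` -/

/-- The shift `f ↦ (n ↦ f (n + 1))` of sequences. -/
def seqShift : (ℕ → ℂ) →ₗ[ℂ] (ℕ → ℂ) := LinearMap.funLeft ℂ ℂ fun n => n + 1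

/-- The operator `∏_{i < N} (S - q^i) / (q)_N`, where `S` is the shift of sequences. -/
noncomputable def newtonDiff (q : ℂ) : ℕ → (ℕ → ℂ) →ₗ[ℂ] (ℕ → ℂ)
  | 0 => LinearMap.id
  | N + 1 => (1 - q ^ (N + 1))⁻¹ • ((seqShift - q ^ N • LinearMap.id) ∘ₗ newtonDiff q N)

@[simp] theorem newtonDiff_zero (q : ℂ) (f : ℕ → ℂ) : newtonDiff q 0 f = f := rfl

theorem one_sub_pow_ne_zero {q : ℂ} (hq : ‖q‖ < 1) (n : ℕ) : 1 - q ^ (n + 1) ≠ 0 := by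
  intro h
  have h1 : ‖q ^ (n + 1)‖ < 1 := by
    rw [norm_pow]
    exact pow_lt_one₀ (norm_nonneg q) hq (Nat.succ_ne_zero n)
  rw [← sub_eq_zero.mp h] at h1
  simp at h1

theorem newtonDiff_succ_apply {q : ℂ} (hq : ‖q‖ < 1) (N : ℕ) (f : ℕ → ℂ) (n : ℕ) :
    (1 - q ^ (N + 1)) * newtonDiff q (N + 1) f n
      = newtonDiff q N f (n + 1) - q ^ N * newtonDiff q N f n := by
  have h := one_sub_pow_ne_zero hq N
  simp [newtonDiff, seqShift, LinearMap.funLeft_apply]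
  field_simp

theorem newtonDiff_succ_eq {q : ℂ} (hq : ‖q‖ < 1) (N : ℕ) (f : ℕ → ℂ) (n : ℕ) :
    newtonDiff q N f (n + 1)
      = q ^ N * newtonDiff q N f n + (1 - q ^ (N + 1)) * newtonDiff q (N + 1) f n := by
  rw [newtonDiff_succ_apply hq]; ring

theorem newtonDiff_shift {q : ℂ} (hq : ‖q‖ < 1) (k N : ℕ) (f : ℕ → ℂ) (n : ℕ) :
    newtonDiff q N (fun m => f (m + k)) n = newtonDiff q N f (n + k) := by
  induction N generalizing n with
  | zero => rfl
  | succ N ih =>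
    refine mul_left_cancel₀ (one_sub_pow_ne_zero hq N) ?_
    rw [newtonDiff_succ_apply hq, newtonDiff_succ_apply hq, ih, ih]
    rw [add_right_comm]

theorem newtonDiff_const_mul (q : ℂ) (c : ℂ) (N : ℕ) (f : ℕ → ℂ) (n : ℕ) :
    newtonDiff q N (fun m => c * f m) n = c * newtonDiff q N f n := by
  have : (fun m => c * f m) = c • f := rfl
  rw [this, map_smul]; rfl

theorem newtonDiff_sub (q : ℂ) (N : ℕ) (f g : ℕ → ℂ) (n : ℕ) :
    newtonDiff q N (fun m => f m - g m) n = newtonDiff q N f n - newtonDiff q N g n := by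
  have : (fun m => f m - g m) = f - g := rfl
  rw [this, map_sub]; rfl

/-- The `q`-Leibniz rule. -/
theorem newtonDiff_mul {q : ℂ} (hq : ‖q‖ < 1) (N : ℕ) (f g : ℕ → ℂ) (n : ℕ) :
    newtonDiff q N (fun m => f m * g m) n
      = ∑ p ∈ Finset.HasAntidiagonal.antidiagonal N,
          newtonDiff q p.1 f n * newtonDiff q p.2 g (n + p.1) := by
  induction N generalizing n with
  | zero => simp
  | succ N ih =>
    refine mul_left_cancel₀ (one_sub_pow_ne_zero hq N) ?_
    rw [newtonDiff_succ_apply hq, ih, ih]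
    -- Here 1 - q^(r+s) = (1 - q^r) + q^r (1 - q^s). The first half lowers the index on f, the
    -- second the index on g, and each vanishes at the end where there is nothing to lower.
    have h1 : (1 - q ^ (N + 1)) * ∑ p ∈ Finset.HasAntidiagonal.antidiagonal (N + 1),
          newtonDiff q p.1 f n * newtonDiff q p.2 g (n + p.1)
        = ∑ p ∈ Finset.HasAntidiagonal.antidiagonal (N + 1),
            (1 - q ^ p.1) * (newtonDiff q p.1 f n * newtonDiff q p.2 g (n + p.1))
          + ∑ p ∈ Finset.HasAntidiagonal.antidiagonal (N + 1),
            q ^ p.1 * (1 - q ^ p.2) * (newtonDiff q p.1 f n * newtonDiff q p.2 g (n + p.1)) := by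
      rw [Finset.mul_sum, ← Finset.sum_add_distrib]
      refine Finset.sum_congr rfl fun p hp => ?_
      rw [← Finset.HasAntidiagonal.mem_antidiagonal.mp hp, pow_add]
      ring
    rw [h1, Finset.Nat.sum_antidiagonal_succ, Finset.Nat.sum_antidiagonal_succ', Finset.mul_sum,
      ← Finset.sum_sub_distrib]
    simp only [pow_zero, sub_self, zero_mul, mul_zero, zero_add, add_zero]
    rw [← Finset.sum_add_distrib]
    refine Finset.sum_congr rfl fun p hp => ?_
    have e1 := newtonDiff_succ_apply hq p.1 f n
    have e2 := newtonDiff_succ_apply hq p.2 g (n + p.1)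
    have e3 : n + (p.1 + 1) = n + p.1 + 1 := by ring
    have e4 : n + 1 + p.1 = n + p.1 + 1 := by ring
    rw [e3, e4, ← Finset.HasAntidiagonal.mem_antidiagonal.mp hp, pow_add]
    linear_combination (-newtonDiff q p.2 g (n + p.1 + 1)) * e1 - q ^ p.1 * newtonDiff q p.1 f n * e2

/-- The case f = q^m of the Leibniz rule, where all differences of order at least 2 vanish. Both
terms on the right are kept at the same base point n; this is the form in which the second equation
telescopes. -/
theorem newtonDiff_pow_mul {q : ℂ} (hq : ‖q‖ < 1) (N : ℕ) (g : ℕ → ℂ) (n : ℕ) :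
    newtonDiff q (N + 1) (fun m => q ^ m * g m) n
      = q ^ (N + 1 + n) * newtonDiff q (N + 1) g n - q ^ (N + n) * newtonDiff q N g n := by
  induction N generalizing n with
  | zero =>
    refine mul_left_cancel₀ (one_sub_pow_ne_zero hq 0) ?_
    have e := newtonDiff_succ_apply hq 0 g n
    rw [newtonDiff_succ_apply hq]
    simp only [newtonDiff_zero] at e ⊢
    linear_combination (-q ^ (0 + 1 + n)) * e
  | succ N ih =>
    refine mul_left_cancel₀ (one_sub_pow_ne_zero hq (N + 1)) ?_
    rw [newtonDiff_succ_apply hq, ih, ih]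
    have e1 := newtonDiff_succ_apply hq (N + 1) g n
    have e2 := newtonDiff_succ_apply hq N g n
    linear_combination (-q ^ (N + 1 + 1 + n)) * e1 + q ^ (N + n + 1) * e2

/-! ### Two partial fraction identities -/

theorem prod_erase_some {ι : Type*} [Fintype ι] [DecidableEq ι] (f : Option ι → ℂ) (i : ι) :
    ∏ x ∈ Finset.univ.erase (some i), f x
      = f none * ∏ j ∈ Finset.univ.erase i, f (some j) := by
  rw [← Finset.prod_insertNone]
  refine Finset.prod_congr ?_ fun _ _ => rfl
  ext x
  cases x <;> simp

theorem prod_erase_none {ι : Type*} [Fintype ι] [DecidableEq ι] (f : Option ι → ℂ) :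
    ∏ x ∈ Finset.univ.erase (none : Option ι), f x = ∏ j, f (some j) := by
  have : Finset.univ.erase (none : Option ι) = Finset.univ.map Function.Embedding.some := by
    ext x
    cases x <;> simp
  rw [this, Finset.prod_map]; rfl

/-- Lagrange interpolation of the monic polynomial ∏ (t - X_j) at the nodes 0 and Y_i: its leading
coefficient 1 is the sum of the nodal contributions, and the node 0 contributes ∏ X / ∏ Y. -/
theorem sum_prod_sub_div {ι : Type*} [Fintype ι] [DecidableEq ι] (Y X : ι → ℂ)
    (hY : Function.Injective Y) (hY0 : ∀ i, Y i ≠ 0) :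
    ∑ i, (∏ j, (Y i - X j)) / (Y i * ∏ j ∈ Finset.univ.erase i, (Y i - Y j))
      = 1 - (∏ j, X j) / ∏ j, Y j := by
  let v : Option ι → ℂ := fun o => o.elim 0 Y
  have hv : Set.InjOn v (Finset.univ : Finset (Option ι)) := by
    rintro (_ | i) - (_ | j) - h
    · rfl
    · exact absurd h.symm (hY0 j)
    · exact absurd h (hY0 i)
    · exact congrArg some (hY h)
  let P : Polynomial ℂ := ∏ j, (Polynomial.X - Polynomial.C (X j))
  have hP : P.natDegree = Fintype.card ι := by
    simp [P, Polynomial.natDegree_prod_of_monic _ _ fun j _ => Polynomial.monic_X_sub_C (X j)]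
  have hm : P.Monic := Polynomial.monic_prod_of_monic _ _ fun j _ => Polynomial.monic_X_sub_C (X j)
  have hd : P.degree < (Finset.univ : Finset (Option ι)).card := by
    rw [Polynomial.degree_eq_natDegree hm.ne_zero, hP, Finset.card_univ, Fintype.card_option]
    exact_mod_cast Nat.lt_succ_self _
  have h := Lagrange.coeff_eq_sum hv hd
  rw [Finset.card_univ, Fintype.card_option, Nat.add_sub_cancel, ← hP, hm.coeff_natDegree,
    Fintype.sum_option] at h
  simp only [prod_erase_some, prod_erase_none] at h
  simp only [P, Polynomial.eval_prod, v, Option.elim, Polynomial.eval_sub, Polynomial.eval_X,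
    Polynomial.eval_C, sub_zero, zero_sub, Finset.prod_neg] at h
  rw [mul_div_mul_left _ _ (by simp)] at h
  rw [h]; ring

/-- The same argument for ∏ (a_j t - X_j) · (β - γ t), of degree at most one more than the number of
Y_i, at the nodes 0, 1 and Y_i. The leading coefficient is -γ ∏ a_j. -/
theorem sum_prod_mul_sub_div {ι : Type*} [Fintype ι] [DecidableEq ι] (Y X a : ι → ℂ) (β γ : ℂ)
    (hY : Function.Injective Y) (hY0 : ∀ i, Y i ≠ 0) (hY1 : ∀ i, Y i ≠ 1) :
    ∑ i, ((∏ j, (a j * Y i - X j)) * (β - γ * Y i))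
        / (Y i * (1 - Y i) * ∏ j ∈ Finset.univ.erase i, (Y i - Y j))
      = (∏ j, a j) * γ - β * ((∏ j, X j) / ∏ j, Y j)
        + (β - γ) * ((∏ j, (a j - X j)) / ∏ j, (1 - Y j)) := by
  let v : Option (Option ι) → ℂ := fun o => o.elim 0 fun o => o.elim 1 Y
  have hv : Set.InjOn v (Finset.univ : Finset (Option (Option ι))) := by
    rintro (_ | _ | i) - (_ | _ | j) - h
    · rfl
    · simp [v] at h
    · exact absurd h.symm (hY0 j)
    · simp [v] at h
    · rfl
    · exact absurd h.symm (hY1 j)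
    · exact absurd h (hY0 i)
    · exact absurd h (hY1 i)
    · exact congrArg (fun i => some (some i)) (hY h)
  let Q : Polynomial ℂ := ∏ j, (Polynomial.C (a j) * Polynomial.X + Polynomial.C (-X j))
  let R : Polynomial ℂ := Polynomial.C (-γ) * Polynomial.X + Polynomial.C β
  have hQ : Q.natDegree ≤ Fintype.card ι := by
    refine (Polynomial.natDegree_prod_le _ _).trans ?_
    refine (Finset.sum_le_sum fun j _ => Polynomial.natDegree_linear_le).trans ?_
    simp
  have hR : R.natDegree ≤ 1 := Polynomial.natDegree_linear_le
  have hQR : (Q * R).natDegree ≤ Fintype.card ι + 1 := Polynomial.natDegree_mul_le_of_le hQ hR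
  have hd : (Q * R).degree < (Finset.univ : Finset (Option (Option ι))).card := by
    rw [Finset.card_univ, Fintype.card_option, Fintype.card_option]
    exact lt_of_le_of_lt (Polynomial.degree_le_of_natDegree_le hQR)
      (by exact_mod_cast Nat.lt_succ_self _)
  have hcQ : Q.coeff (Fintype.card ι) = ∏ j, a j := by
    have := Polynomial.coeff_prod_of_natDegree_le (s := (Finset.univ : Finset ι))
      (fun j => Polynomial.C (a j) * Polynomial.X + Polynomial.C (-X j)) 1
      (fun j _ => Polynomial.natDegree_linear_le)
    rw [Finset.card_univ, mul_one] at this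
    rw [this]
    refine Finset.prod_congr rfl fun j _ => ?_
    simp [Polynomial.coeff_C]
  have hc : (Q * R).coeff (Fintype.card ι + 1) = -((∏ j, a j) * γ) := by
    rw [Polynomial.coeff_mul_add_eq_of_natDegree_le hQ hR, hcQ]
    simp [R, Polynomial.coeff_C]
  have h := Lagrange.coeff_eq_sum hv hd
  rw [Finset.card_univ, Fintype.card_option, Fintype.card_option, Nat.add_sub_cancel, hc,
    Fintype.sum_option, Fintype.sum_option] at h
  simp only [prod_erase_some, prod_erase_none, Fintype.prod_option] at h
  simp only [Q, R, Polynomial.eval_mul, Polynomial.eval_prod, v, Option.elim, Polynomial.eval_add,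
    Polynomial.eval_X, Polynomial.eval_C, sub_zero, zero_sub, Finset.prod_neg, mul_zero,
    zero_add, mul_one, one_mul] at h
  have hs : ((-1 : ℂ)) ^ (Finset.univ : Finset ι).card ≠ 0 := by simp
  have e1 : ((-1 : ℂ) ^ (Finset.univ : Finset ι).card * ∏ j, X j) * β
      / (-1 * ((-1) ^ (Finset.univ : Finset ι).card * ∏ j, Y j))
      = - (β * ((∏ j, X j) / ∏ j, Y j)) := by
    have : ∏ j, Y j ≠ 0 := Finset.prod_ne_zero_iff.mpr fun i _ => hY0 i
    field_simp
  rw [e1] at h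
  have e2 : ∀ i, ((∏ j, (a j * Y i - X j)) * (β - γ * Y i))
        / (Y i * (1 - Y i) * ∏ j ∈ Finset.univ.erase i, (Y i - Y j))
      = - ((∏ j, (a j * Y i + - X j)) * (-γ * Y i + β)
        / (Y i * ((Y i - 1) * ∏ j ∈ Finset.univ.erase i, (Y i - Y j)))) := by
    intro i
    rw [← div_neg]
    congr 1
    · simp only [sub_eq_add_neg]; ring
    · ring
  simp only [e2, Finset.sum_neg_distrib]
  simp only [sub_eq_add_neg] at h ⊢
  
  linear_combination h

section

/-! ### Finite multiple sums of Milne type -/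

theorem vdm_eq_prod_erase {M : ℕ} (y : Fin M → ℂ) (k : Fin M) :
    vdm y = (∏ i ∈ Finset.univ.erase k, ∏ j ∈ Finset.univ.erase k, if i < j then y i - y j else 1)
      * ∏ j ∈ Finset.univ.erase k, ((if k < j then 1 else -1) * (y k - y j)) := by
  have h1 : vdm y = ∏ i, ∏ j, if i < j then y i - y j else 1 := by
    refine Finset.prod_congr rfl fun i _ => ?_
    rw [← Finset.prod_filter]
    refine Finset.prod_congr ?_ fun _ _ => rfl
    ext j; simp
  have h2 : ∀ i, (∏ j, if i < j then y i - y j else 1)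
      = (if i < k then y i - y k else 1)
        * ∏ j ∈ Finset.univ.erase k, if i < j then y i - y j else 1 :=
    fun i => (Finset.mul_prod_erase Finset.univ (fun j => if i < j then y i - y j else (1 : ℂ))
      (Finset.mem_univ k)).symm
  rw [h1, ← Finset.mul_prod_erase Finset.univ (fun i => ∏ j, if i < j then y i - y j else (1 : ℂ))
    (Finset.mem_univ k), h2 k, if_neg (lt_irrefl k), one_mul]
  simp only [h2, Finset.prod_mul_distrib]
  rw [← mul_assoc, mul_comm, ← Finset.prod_mul_distrib]
  refine congrArg₂ _ rfl (Eq.trans ?_ Finset.prod_mul_distrib)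
  refine Finset.prod_congr rfl fun j hj => ?_
  rcases lt_trichotomy k j with h | h | h
  · simp [h, h.not_gt]
  · exact absurd h.symm (Finset.ne_of_mem_erase hj)
  · simp [h, h.not_gt]

/-- Only the factors containing the k-th entry change, and their ordering signs agree on both sides.
The cross-multiplied form needs no nonvanishing. -/
theorem vdm_update {M : ℕ} (y : Fin M → ℂ) (k : Fin M) (v : ℂ) :
    vdm (Function.update y k v) * ∏ j ∈ Finset.univ.erase k, (y k - y j)
      = vdm y * ∏ j ∈ Finset.univ.erase k, (v - y j) := by
  rw [vdm_eq_prod_erase _ k, vdm_eq_prod_erase y k]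
  have h1 : ∏ i ∈ Finset.univ.erase k, ∏ j ∈ Finset.univ.erase k,
        (if i < j then Function.update y k v i - Function.update y k v j else 1)
      = ∏ i ∈ Finset.univ.erase k, ∏ j ∈ Finset.univ.erase k, if i < j then y i - y j else 1 := by
    refine Finset.prod_congr rfl fun i hi => Finset.prod_congr rfl fun j hj => ?_
    rw [Function.update_of_ne (Finset.ne_of_mem_erase hi),
      Function.update_of_ne (Finset.ne_of_mem_erase hj)]
  have h2 : ∏ j ∈ Finset.univ.erase k,
        ((if k < j then (1 : ℂ) else -1) * (Function.update y k v k - Function.update y k v j))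
      = ∏ j ∈ Finset.univ.erase k, ((if k < j then (1 : ℂ) else -1) * (v - y j)) := by
    refine Finset.prod_congr rfl fun j hj => ?_
    rw [Function.update_of_ne (Finset.ne_of_mem_erase hj), Function.update_self]
  rw [h1, h2, Finset.prod_mul_distrib, Finset.prod_mul_distrib]
  ring

theorem vdm_const_mul {M : ℕ} (c : ℂ) (y : Fin M → ℂ) :
    vdm (fun i => c * y i) = (∏ i : Fin M, ∏ _j ∈ Finset.Ioi i, c) * vdm y := by
  simp only [vdm, ← mul_sub, Finset.prod_mul_distrib]

theorem vdm_ne_zero {M : ℕ} {y : Fin M → ℂ} (hy : Function.Injective y) : vdm y ≠ 0 := by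
  refine Finset.prod_ne_zero_iff.mpr fun i _ => Finset.prod_ne_zero_iff.mpr fun j hj => ?_
  exact sub_ne_zero.mpr fun h => (Finset.mem_Ioi.mp hj).ne (hy h)

@[simp] theorem qPoch_zero (q a : ℂ) : qPoch q a 0 = 1 := rfl

theorem qPoch_succ (q a : ℂ) (n : ℕ) : qPoch q a (n + 1) = qPoch q a n * (1 - a * q ^ n) :=
  Finset.prod_range_succ _ _

theorem qPoch_succ' (q a : ℂ) (n : ℕ) : qPoch q a (n + 1) = (1 - a) * qPoch q (q * a) n := by
  rw [qPoch, Finset.prod_range_succ', mul_comm]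
  congr 1
  · simp
  · exact Finset.prod_congr rfl fun k _ => by ring

theorem qPoch_ne_zero {q a : ℂ} (h : ∀ n : ℕ, a * q ^ n ≠ 1) (n : ℕ) : qPoch q a n ≠ 0 :=
  Finset.prod_ne_zero_iff.mpr fun k _ => sub_ne_zero.mpr (h k).symm

theorem qPoch_add (q a : ℂ) (m n : ℕ) :
    qPoch q a (m + n) = qPoch q a m * qPoch q (a * q ^ m) n := by
  rw [qPoch, Finset.prod_range_add]
  congr 1
  exact Finset.prod_congr rfl fun k _ => by ring

/-- The points `X` for which none of `X_i`, `(X_i)_n`, `(q X_i / X_j)_n` and `Δ(X)` vanishes. -/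
def IsGeneric {M : ℕ} (q : ℂ) (X : Fin M → ℂ) : Prop :=
  (∀ i, X i ≠ 0) ∧ (∀ i, ∀ n : ℕ, X i * q ^ n ≠ 1) ∧ ∀ i j, i ≠ j → ∀ n : ℕ, X i * q ^ n ≠ X j

namespace IsGeneric

variable {M : ℕ} {q : ℂ} {X : Fin M → ℂ}

theorem const_mul (h : IsGeneric q X) (hq : q ≠ 0) : IsGeneric q fun i => q * X i := by
  refine ⟨fun i => mul_ne_zero hq (h.1 i), fun i n => ?_, fun i j hij n => ?_⟩
  · have := h.2.1 i (n + 1)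
    rwa [pow_succ', ← mul_assoc, mul_comm (X i)] at this
  · exact fun e => h.2.2 i j hij n (mul_left_cancel₀ hq (by rw [← mul_assoc, e]))

theorem injective_mul_pow (h : IsGeneric q X) (hq : q ≠ 0) (l : Fin M → ℕ) :
    Function.Injective fun i => X i * q ^ l i := by
  have key : ∀ i j, l j ≤ l i → X i * q ^ l i = X j * q ^ l j → i = j := by
    intro i j hl e
    by_contra hij
    refine h.2.2 i j hij (l i - l j) (mul_right_cancel₀ (pow_ne_zero (l j) hq) ?_)
    rw [mul_assoc, ← pow_add, Nat.sub_add_cancel hl, e]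
  intro i j e
  rcases le_total (l j) (l i) with hl | hl
  · exact key i j hl e
  · exact (key j i hl e.symm).symm

theorem injective (h : IsGeneric q X) (hq : q ≠ 0) : Function.Injective X := by
  simpa using h.injective_mul_pow hq 0

theorem mul_div_mul_pow_ne_one (h : IsGeneric q X) (hq : ‖q‖ < 1) (i j : Fin M) (n : ℕ) :
    q * X i / X j * q ^ n ≠ 1 := by
  intro e
  have hj := h.1 j
  rcases eq_or_ne i j with rfl | hij
  · have : q * X i / X i * q ^ n = q ^ (n + 1) := by field_simp; ring
    exact one_sub_pow_ne_zero hq n (sub_eq_zero.mpr (this ▸ e).symm)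
  · refine h.2.2 i j hij (n + 1) ?_
    field_simp at e
    rw [← e]; ring

end IsGeneric

/-- The factor attached to the index `i` in the summand of a Milne type sum. -/
noncomputable def milneFactor {M : ℕ} (q : ℂ) (a X : Fin M → ℂ) (β γ : ℂ) (i : Fin M) (n : ℕ) : ℂ :=
  (∏ j, qPoch q (a j * X i / X j) n) / (∏ j, qPoch q (q * X i / X j) n)
    * ((∏ k ∈ Finset.range n, (β - γ * X i * q ^ k)) / qPoch q (X i) n)

/-- The summand of a Milne type sum. -/
noncomputable def milneTerm {M : ℕ} (q : ℂ) (a X : Fin M → ℂ) (β γ : ℂ) (l : Fin M → ℕ) : ℂ :=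
  vdm (fun i => X i * q ^ l i) / vdm X * ∏ i, milneFactor q a X β γ i (l i)

/-- The sum of the Milne type summands with `l_1 + ⋯ + l_M = N`. -/
noncomputable def milneSum {M : ℕ} (q : ℂ) (a X : Fin M → ℂ) (β γ : ℂ) (N : ℕ) : ℂ :=
  ∑ l ∈ Finset.piAntidiag Finset.univ N, milneTerm q a X β γ l

variable {M : ℕ} {q : ℂ} {X : Fin M → ℂ}

theorem milneFactor_succ (hq : ‖q‖ < 1) (hX : IsGeneric q X) (a : Fin M → ℂ) (β γ : ℂ) (i : Fin M)
    (n : ℕ) :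
    milneFactor q a X β γ i (n + 1) * (∏ j, (q * (X i * q ^ n) - X j)) * (1 - X i * q ^ n)
      = milneFactor q a X β γ i n * (∏ j, (a j * (X i * q ^ n) - X j))
        * (β - γ * (X i * q ^ n)) := by
  have e1 : ∏ j, (q * (X i * q ^ n) - X j)
      = (∏ j, -X j) * ∏ j, (1 - q * X i / X j * q ^ n) := by
    rw [← Finset.prod_mul_distrib]
    refine Finset.prod_congr rfl fun j _ => ?_
    have := hX.1 j
    field_simp; ring
  have e2 : ∏ j, (a j * (X i * q ^ n) - X j)
      = (∏ j, -X j) * ∏ j, (1 - a j * X i / X j * q ^ n) := by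
    rw [← Finset.prod_mul_distrib]
    refine Finset.prod_congr rfl fun j _ => ?_
    have := hX.1 j
    field_simp; ring
  have h1 : 1 - X i * q ^ n ≠ 0 := sub_ne_zero.mpr (hX.2.1 i n).symm
  have h2 : ∏ j, (1 - q * X i / X j * q ^ n) ≠ 0 := Finset.prod_ne_zero_iff.mpr fun j _ =>
    sub_ne_zero.mpr (hX.mul_div_mul_pow_ne_one hq i j n).symm
  have h3 : ∏ j, qPoch q (q * X i / X j) n ≠ 0 := Finset.prod_ne_zero_iff.mpr fun j _ =>
    qPoch_ne_zero (hX.mul_div_mul_pow_ne_one hq i j) n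
  have h4 : qPoch q (X i) n ≠ 0 := qPoch_ne_zero (hX.2.1 i) n
  rw [e1, e2]
  simp only [milneFactor, qPoch_succ, Finset.prod_mul_distrib, Finset.prod_range_succ]
  generalize (∏ j, (1 - q * X i / X j * q ^ n)) = P1 at *
  generalize (∏ j, qPoch q (q * X i / X j) n) = P2 at *
  generalize (∏ j, (1 - a j * X i / X j * q ^ n)) = P3
  generalize (∏ j, qPoch q (a j * X i / X j) n) = P4
  generalize (∏ k ∈ Finset.range n, (β - γ * X i * q ^ k)) = P5
  field_simp

/-- Raising l_i by one turns a summand of the first partial fraction sum, taken at the raised point,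
into a summand of the second one taken at l. -/
theorem milneTerm_update (hq0 : q ≠ 0) (hq : ‖q‖ < 1) (hX : IsGeneric q X) (a : Fin M → ℂ)
    (β γ : ℂ) (l : Fin M → ℕ) (i : Fin M) (Y : Fin M → ℂ) (hY : Y = fun i => X i * q ^ l i) :
    milneTerm q a X β γ (Function.update l i (l i + 1))
        * ((∏ j, (q * Y i - X j)) / (q * Y i * ∏ j ∈ Finset.univ.erase i, (q * Y i - Y j)))
      = milneTerm q a X β γ l
        * (((∏ j, (a j * Y i - X j)) * (β - γ * Y i))
          / (Y i * (1 - Y i) * ∏ j ∈ Finset.univ.erase i, (Y i - Y j)) / q) := by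
  have hYi : Y i = X i * q ^ l i := by rw [hY]
  have hv : (fun k => X k * q ^ Function.update l i (l i + 1) k)
      = Function.update Y i (q * Y i) := by
    funext k
    rcases eq_or_ne k i with rfl | hk
    · simp [hY, pow_succ]; ring
    · simp [hY, Function.update_of_ne hk]
  have hinj := hX.injective_mul_pow hq0 (Function.update l i (l i + 1))
  have hinj' := hX.injective_mul_pow hq0 l
  rw [hv] at hinj
  rw [← hY] at hinj'
  have hp : ∏ j ∈ Finset.univ.erase i, (q * Y i - Y j) ≠ 0 := by
    refine Finset.prod_ne_zero_iff.mpr fun j hj => sub_ne_zero.mpr fun e => ?_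
    have hji := Finset.ne_of_mem_erase hj
    refine hji.symm (hinj (?_ : Function.update Y i (q * Y i) i = Function.update Y i (q * Y i) j))
    rw [Function.update_self, Function.update_of_ne hji, e]
  have hp' : ∏ j ∈ Finset.univ.erase i, (Y i - Y j) ≠ 0 := by
    refine Finset.prod_ne_zero_iff.mpr fun j hj => sub_ne_zero.mpr fun e => ?_
    exact (Finset.ne_of_mem_erase hj).symm (hinj' e)
  have hf : ∏ k, milneFactor q a X β γ k (Function.update l i (l i + 1) k)
      = milneFactor q a X β γ i (l i + 1)
        * ∏ k ∈ Finset.univ.erase i, milneFactor q a X β γ k (l k) := by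
    rw [← Finset.mul_prod_erase _ _ (Finset.mem_univ i), Function.update_self]
    congr 1
    exact Finset.prod_congr rfl fun k hk => by
      rw [Function.update_of_ne (Finset.ne_of_mem_erase hk)]
  have hf' : ∏ k, milneFactor q a X β γ k (l k)
      = milneFactor q a X β γ i (l i)
        * ∏ k ∈ Finset.univ.erase i, milneFactor q a X β γ k (l k) :=
    (Finset.mul_prod_erase _ _ (Finset.mem_univ i)).symm
  have hs := milneFactor_succ hq hX a β γ i (l i)
  rw [← hYi] at hs
  have hu := vdm_update Y i (q * Y i)
  have hY0 : Y i ≠ 0 := hYi ▸ mul_ne_zero (hX.1 i) (pow_ne_zero _ hq0)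
  have hY1 : 1 - Y i ≠ 0 := hYi ▸ sub_ne_zero.mpr (hX.2.1 i _).symm
  have hV : vdm X ≠ 0 := vdm_ne_zero (hX.injective hq0)
  rw [milneTerm, milneTerm, hv, hf, hf', ← hY]
  generalize vdm (Function.update Y i (q * Y i)) = V1 at *
  generalize (∏ j ∈ Finset.univ.erase i, (q * Y i - Y j)) = P1 at *
  generalize (∏ j ∈ Finset.univ.erase i, (Y i - Y j)) = P2 at *
  generalize (∏ k ∈ Finset.univ.erase i, milneFactor q a X β γ k (l k)) = F at *
  generalize milneFactor q a X β γ i (l i) = F0 at *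
  generalize milneFactor q a X β γ i (l i + 1) = F1 at *
  generalize (∏ j, (q * Y i - X j)) = Q1 at *
  generalize (∏ j, (a j * Y i - X j)) = Q2 at *
  generalize vdm Y = V2 at *
  field_simp
  linear_combination (F * F1 * Q1 * (1 - Y i)) * hu + (F * V2 * P1) * hs

/-- Raising l_i is a bijection from the tuples of sum N onto those of sum N + 1 with l_i ≥ 1; the
hypothesis on f disposes of the rest. -/
theorem sum_piAntidiag_succ {ι : Type*} [Fintype ι] [DecidableEq ι] (N : ℕ) (i : ι)
    (f : (ι → ℕ) → ℂ) (hf : ∀ l, l i = 0 → f l = 0) :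
    ∑ l ∈ Finset.piAntidiag Finset.univ (N + 1), f l
      = ∑ l ∈ Finset.piAntidiag Finset.univ N, f (Function.update l i (l i + 1)) := by
  have hsum : ∀ (l : ι → ℕ) (n : ℕ),
      ∑ j, Function.update l i n j = n + ∑ j ∈ Finset.univ.erase i, l j := by
    intro l n
    rw [← Finset.add_sum_erase _ _ (Finset.mem_univ i), Function.update_self]
    congr 1
    exact Finset.sum_congr rfl fun k hk => by
      rw [Function.update_of_ne (Finset.ne_of_mem_erase hk)]
  symm
  refine Finset.sum_of_injOn (fun l => Function.update l i (l i + 1)) ?_ ?_ ?_ fun _ _ => rfl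
  · intro l _ l' _ h
    funext k
    have hk := congrFun h k
    rcases eq_or_ne k i with rfl | hne
    · simpa using hk
    · simpa [Function.update_of_ne hne] using hk
  · intro l hl
    simp only [Finset.mem_univ, implies_true, and_true,
      Finset.mem_coe, Finset.mem_piAntidiag] at hl ⊢
    rw [hsum, ← hl, ← Finset.add_sum_erase _ _ (Finset.mem_univ i)]
    ring
  · intro l hl hl'
    refine hf l ?_
    by_contra h0
    refine hl' ⟨Function.update l i (l i - 1), ?_, ?_⟩
    · simp only [Finset.mem_univ, implies_true, and_true,
        Finset.mem_coe, Finset.mem_piAntidiag] at hl ⊢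
      rw [← Finset.add_sum_erase _ _ (Finset.mem_univ i)] at hl
      rw [hsum]
      omega
    · simp [Nat.sub_add_cancel (Nat.one_le_iff_ne_zero.mpr h0)]

theorem prod_mul_pow_eq (X : Fin M → ℂ) (l : Fin M → ℕ) :
    ∏ i, X i * q ^ l i = (∏ i, X i) * q ^ ∑ i, l i := by
  rw [Finset.prod_mul_distrib, Finset.prod_pow_eq_pow_sum]

/-- On |l| = N + 1 the constant 1 - q^{-(N+1)} equals 1 - ∏ X_j / ∏ X_j q^{l_j}, which the first
partial fraction identity writes as a sum over i. In the i-th piece l_i is lowered by one, and the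
second identity then performs the sum over i. -/
theorem milneSum_succ_aux (hq0 : q ≠ 0) (hq : ‖q‖ < 1) (hX : IsGeneric q X) (a : Fin M → ℂ)
    (β γ : ℂ) (N : ℕ) :
    (1 - (q ^ (N + 1))⁻¹) * milneSum q a X β γ (N + 1)
      = ∑ l ∈ Finset.piAntidiag Finset.univ N, milneTerm q a X β γ l
        * (((∏ j, a j) * γ - β * (q ^ N)⁻¹
          + (β - γ) * ((∏ j, (a j - X j)) / ∏ j, (1 - X j * q ^ l j))) / q) := by
  have hX0 : ∏ j, X j ≠ 0 := Finset.prod_ne_zero_iff.mpr fun j _ => hX.1 j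
  have hr : ∀ (K : ℕ), ∀ l ∈ Finset.piAntidiag (Finset.univ : Finset (Fin M)) K,
      (∏ j, X j) / ∏ j, X j * q ^ l j = (q ^ K)⁻¹ := by
    intro K l hl
    rw [prod_mul_pow_eq, (Finset.mem_piAntidiag.mp hl).1]
    field_simp
  have h1 : (1 - (q ^ (N + 1))⁻¹) * milneSum q a X β γ (N + 1)
      = ∑ i, ∑ l ∈ Finset.piAntidiag Finset.univ (N + 1), milneTerm q a X β γ l
        * ((∏ j, (X i * q ^ l i - X j))
          / (X i * q ^ l i * ∏ j ∈ Finset.univ.erase i, (X i * q ^ l i - X j * q ^ l j))) := by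
    rw [Finset.sum_comm, milneSum, Finset.mul_sum]
    refine Finset.sum_congr rfl fun l hl => ?_
    rw [← hr _ l hl, ← sum_prod_sub_div _ X (hX.injective_mul_pow hq0 l)
      fun i => mul_ne_zero (hX.1 i) (pow_ne_zero _ hq0), Finset.sum_mul]
    exact Finset.sum_congr rfl fun i _ => mul_comm _ _
  rw [h1]
  have h2 : ∀ i, ∑ l ∈ Finset.piAntidiag Finset.univ (N + 1), milneTerm q a X β γ l
        * ((∏ j, (X i * q ^ l i - X j))
          / (X i * q ^ l i * ∏ j ∈ Finset.univ.erase i, (X i * q ^ l i - X j * q ^ l j)))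
      = ∑ l ∈ Finset.piAntidiag Finset.univ N, milneTerm q a X β γ l
        * (((∏ j, (a j * (X i * q ^ l i) - X j)) * (β - γ * (X i * q ^ l i)))
          / (X i * q ^ l i * (1 - X i * q ^ l i)
            * ∏ j ∈ Finset.univ.erase i, (X i * q ^ l i - X j * q ^ l j)) / q) := by
    intro i
    rw [sum_piAntidiag_succ N i]
    · refine Finset.sum_congr rfl fun l _ => ?_
      rw [← milneTerm_update hq0 hq hX a β γ l i _ rfl]
      have e : X i * q ^ (l i + 1) = q * (X i * q ^ l i) := by ring
      have e' : ∏ j ∈ Finset.univ.erase i,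
            (q * (X i * q ^ l i) - X j * q ^ (Function.update l i (l i + 1) j))
          = ∏ j ∈ Finset.univ.erase i, (q * (X i * q ^ l i) - X j * q ^ l j) :=
        Finset.prod_congr rfl fun j hj => by
          rw [Function.update_of_ne (Finset.ne_of_mem_erase hj)]
      simp only [Function.update_self, e, e']
    -- For l_i = 0 the factor j = i of ∏ (X_i q^{l_i} - X_j) is zero.
    · intro l hl
      rw [Finset.prod_eq_zero (Finset.mem_univ i) (by simp [hl])]
      simp
  simp only [h2]
  rw [Finset.sum_comm]
  refine Finset.sum_congr rfl fun l hl => ?_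
  rw [← Finset.mul_sum, ← Finset.sum_div, sum_prod_mul_sub_div _ X a β γ
    (hX.injective_mul_pow hq0 l) (fun i => mul_ne_zero (hX.1 i) (pow_ne_zero _ hq0))
    (fun i => hX.2.1 i _), hr _ l hl]

/-- The extra denominator is absorbed by (X)_l (1 - X q^l) = (1 - X) (qX)_l. All other factors
depend on ratios of the X_i or on γ X_i, so replacing X by qX and γ by γ/q leaves them unchanged. -/
theorem milneTerm_div_prod (hq0 : q ≠ 0) (hX : IsGeneric q X) (a : Fin M → ℂ)
    (β γ : ℂ) (l : Fin M → ℕ) :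
    milneTerm q a X β γ l / ∏ j, (1 - X j * q ^ l j)
      = milneTerm q a (fun i => q * X i) β (γ / q) l / ∏ j, (1 - X j) := by
  have hv : vdm (fun i => q * X i * q ^ l i) / vdm (fun i => q * X i)
      = vdm (fun i => X i * q ^ l i) / vdm X := by
    simp only [mul_assoc]
    rw [vdm_const_mul, vdm_const_mul, mul_div_mul_left]
    exact Finset.prod_ne_zero_iff.mpr fun i _ => Finset.prod_ne_zero_iff.mpr fun j _ => hq0
  rw [milneTerm, milneTerm, hv, mul_div_assoc, mul_div_assoc, ← Finset.prod_div_distrib,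
    ← Finset.prod_div_distrib]
  congr 1
  refine Finset.prod_congr rfl fun i _ => ?_
  have h1 : ∀ c j, c * (q * X i) / (q * X j) = c * X i / X j := by
    intro c j
    rw [mul_left_comm, mul_div_mul_left _ _ hq0]
  have h2 : ∀ k, γ / q * (q * X i) * q ^ k = γ * X i * q ^ k := by
    intro k; field_simp
  have h3 : 1 - X i ≠ 0 := sub_ne_zero.mpr (by simpa using (hX.2.1 i 0).symm)
  have h4 : 1 - X i * q ^ l i ≠ 0 := sub_ne_zero.mpr (hX.2.1 i _).symm
  have h5 : qPoch q (X i) (l i) * (1 - X i * q ^ l i) = (1 - X i) * qPoch q (q * X i) (l i) := by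
    rw [← qPoch_succ, qPoch_succ']
  simp only [milneFactor, h1, h2]
  rw [mul_div_assoc, mul_div_assoc, div_div, div_div, h5, mul_comm (1 - X i)]

theorem milneSum_succ (hq0 : q ≠ 0) (hq : ‖q‖ < 1) (hX : IsGeneric q X) (a : Fin M → ℂ)
    (β γ : ℂ) (N : ℕ) :
    (1 - q ^ (N + 1)) * milneSum q a X β γ (N + 1)
      = (β - (∏ j, a j) * γ * q ^ N) * milneSum q a X β γ N
        + (γ - β) * q ^ N * ((∏ j, (a j - X j)) / ∏ j, (1 - X j))
          * milneSum q a (fun i => q * X i) β (γ / q) N := by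
  have h := milneSum_succ_aux hq0 hq hX a β γ N
  have h2 : ∑ l ∈ Finset.piAntidiag Finset.univ N, milneTerm q a X β γ l
        * (((∏ j, a j) * γ - β * (q ^ N)⁻¹
          + (β - γ) * ((∏ j, (a j - X j)) / ∏ j, (1 - X j * q ^ l j))) / q)
      = (((∏ j, a j) * γ - β * (q ^ N)⁻¹) / q) * milneSum q a X β γ N
        + (β - γ) / q * ((∏ j, (a j - X j)) / ∏ j, (1 - X j))
          * milneSum q a (fun i => q * X i) β (γ / q) N := by
    rw [milneSum, milneSum, Finset.mul_sum, Finset.mul_sum, ← Finset.sum_add_distrib]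
    refine Finset.sum_congr rfl fun l _ => ?_
    have e := milneTerm_div_prod hq0 hX a β γ l
    simp only [div_eq_mul_inv] at e ⊢
    linear_combination ((β - γ) * q⁻¹ * (∏ j, (a j - X j))) * e
  rw [h2] at h
  have h3 : (1 - q ^ (N + 1)) = - q ^ (N + 1) * (1 - (q ^ (N + 1))⁻¹) := by
    field_simp; ring
  rw [h3, mul_assoc, h]
  field_simp
  ring

end

section

/-! ### Evaluation of the finite sums -/

/-- `n ↦ ∏_i (X_i / a_i)_n / (X_i)_n`. -/
noncomputable def pochRatio {M : ℕ} (q : ℂ) (a X : Fin M → ℂ) (n : ℕ) : ℂ :=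
  ∏ i, qPoch q (X i / a i) n / qPoch q (X i) n

@[simp] theorem pochRatio_zero {M : ℕ} (q : ℂ) (a X : Fin M → ℂ) : pochRatio q a X 0 = 1 := by
  simp [pochRatio]

variable {M : ℕ} {q : ℂ} {a X : Fin M → ℂ}

theorem pochRatio_one (ha : ∀ i, a i ≠ 0) :
    (∏ i, a i) * pochRatio q a X 1 = (∏ i, (a i - X i)) / ∏ i, (1 - X i) := by
  rw [pochRatio, ← Finset.prod_mul_distrib, ← Finset.prod_div_distrib]
  refine Finset.prod_congr rfl fun i _ => ?_
  have := ha i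
  simp only [qPoch, Finset.prod_range_one, pow_zero, mul_one]
  rw [mul_div_assoc']
  congr 1
  field_simp

theorem pochRatio_succ (n : ℕ) :
    pochRatio q a X (n + 1) = pochRatio q a X 1 * pochRatio q a (fun i => q * X i) n := by
  rw [pochRatio, pochRatio, pochRatio, ← Finset.prod_mul_distrib]
  refine Finset.prod_congr rfl fun i _ => ?_
  rw [qPoch_succ' q (X i), qPoch_succ' q (X i / a i), mul_div_mul_comm, ← mul_div_assoc q]
  simp [qPoch]

theorem qPoch_self_ne_zero (hq : ‖q‖ < 1) (n : ℕ) : qPoch q q n ≠ 0 :=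
  qPoch_ne_zero (fun k h => one_sub_pow_ne_zero hq k (by rw [pow_succ', h, sub_self])) n

/-- `β^m (c q^k)_m / (q)_m`. -/
noncomputable def binomCoeff (q c β : ℂ) (k m : ℕ) : ℂ :=
  β ^ m * qPoch q (c * q ^ k) m / qPoch q q m

@[simp] theorem binomCoeff_zero (q c β : ℂ) (k : ℕ) : binomCoeff q c β k 0 = 1 := by
  simp [binomCoeff]

theorem binomCoeff_succ (hq : ‖q‖ < 1) (c β : ℂ) (k m : ℕ) :
    (1 - q ^ (m + 1)) * binomCoeff q c β k (m + 1)
      = β * (1 - c * q ^ (k + m)) * binomCoeff q c β k m := by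
  have h1 := qPoch_self_ne_zero hq m
  have h2 := one_sub_pow_ne_zero hq m
  rw [binomCoeff, binomCoeff, qPoch_succ, qPoch_succ q q, ← pow_succ' q m,
    mul_assoc c, ← pow_add]
  generalize 1 - q ^ (m + 1) = d at *
  field_simp
  ring

theorem binomCoeff_succ' (hq : ‖q‖ < 1) (c β : ℂ) (k m : ℕ) :
    (1 - q ^ (m + 1)) * binomCoeff q c β k (m + 1)
      = β * (1 - c * q ^ k) * binomCoeff q c β (k + 1) m := by
  have h1 := qPoch_self_ne_zero hq m
  have h2 := one_sub_pow_ne_zero hq m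
  rw [binomCoeff, binomCoeff, qPoch_succ', qPoch_succ q q, ← pow_succ' q m,
    show q * (c * q ^ k) = c * q ^ (k + 1) by ring]
  generalize 1 - q ^ (m + 1) = d at *
  field_simp
  ring

/-- Replacing X by qX amounts, up to the factor `pochRatio q a X 1`, to shifting the sequence by
one, and a shift of D_k is expressed by D_k and D_{k+1} at the same point. -/
theorem newtonDiff_pochRatio_mul (hq : ‖q‖ < 1) (k : ℕ) :
    pochRatio q a X 1 * newtonDiff q k (pochRatio q a fun i => q * X i) 0
      = q ^ k * newtonDiff q k (pochRatio q a X) 0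
        + (1 - q ^ (k + 1)) * newtonDiff q (k + 1) (pochRatio q a X) 0 := by
  rw [← newtonDiff_succ_eq hq, ← newtonDiff_const_mul, ← newtonDiff_shift hq 1]
  have : (fun n => pochRatio q a X 1 * pochRatio q a (fun i => q * X i) n)
      = fun n => pochRatio q a X (n + 1) := funext fun n => (pochRatio_succ n).symm
  rw [this]

theorem milneSum_zero (hq0 : q ≠ 0) (hX : IsGeneric q X) (β γ : ℂ) :
    milneSum q a X β γ 0 = 1 := by
  have hV : vdm X ≠ 0 := vdm_ne_zero (hX.injective hq0)
  simp [milneSum, milneTerm, milneFactor, hV]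

/-- Induction on N for all X and γ at once, because the recurrence calls the sum at (qX, γ/q). Both
sides are shown to satisfy the recurrence of `milneSum_succ`. -/
theorem milneSum_eq (hq0 : q ≠ 0) (hq : ‖q‖ < 1) (ha : ∀ i, a i ≠ 0) (hX : IsGeneric q X)
    (β γ : ℂ) (N : ℕ) :
    milneSum q a X β γ N = ∑ p ∈ Finset.HasAntidiagonal.antidiagonal N,
      newtonDiff q p.1 (pochRatio q a X) 0
        * ((∏ i, a i) ^ p.1 * ∏ i ∈ Finset.range p.1, (γ - β * q ^ i))
        * binomCoeff q (∏ i, a i) β p.1 p.2 := by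
  induction N generalizing X γ with
  | zero => simp [milneSum_zero hq0 hX]
  | succ N ih =>
    refine mul_left_cancel₀ (one_sub_pow_ne_zero hq N) ?_
    rw [milneSum_succ hq0 hq hX, ih hX, ih (hX.const_mul hq0), ← pochRatio_one ha]
    set c := ∏ i, a i
    set R := fun k => newtonDiff q k (pochRatio q a X) 0
    set g : ℕ → ℂ := fun k => c ^ k * ∏ i ∈ Finset.range k, (γ - β * q ^ i)
    have hg : ∀ k, g (k + 1) = g k * (c * (γ - β * q ^ k)) := by
      intro k
      simp only [g, Finset.prod_range_succ, pow_succ]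
      ring
    have hg' : ∀ k, (γ - β) * c * (c ^ k * ∏ i ∈ Finset.range k, (γ / q - β * q ^ i)) * q ^ k
        = g (k + 1) := by
      intro k
      have e : (∏ i ∈ Finset.range k, (γ / q - β * q ^ i)) * q ^ k
          = ∏ i ∈ Finset.range k, (γ - β * q ^ (i + 1)) := by
        rw [Finset.pow_eq_prod_const, ← Finset.prod_mul_distrib]
        refine Finset.prod_congr rfl fun i _ => ?_
        field_simp; ring
      simp only [g, Finset.prod_range_succ', pow_zero, mul_one]
      rw [← e]; ring
    -- The factor 1 - q^(N+1) is distributed over two kinds of terms: u lowers the second index and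
    -- v the first. Each is 0 on the edge where its index cannot be lowered, so both sums reindex to
    -- total order N.
    let u : ℕ × ℕ → ℂ := fun p => match p.2 with
      | 0 => 0
      | m + 1 => β * (1 - c * q ^ (p.1 + p.1 + m)) * binomCoeff q c β p.1 m * (R p.1 * g p.1)
    let v : ℕ × ℕ → ℂ := fun p => match p.1 with
      | 0 => 0
      | k + 1 => q ^ p.2 * (1 - q ^ (k + 1)) * binomCoeff q c β k p.2 * (R (k + 1) * g (k + 1))
    have hu : ∑ p ∈ Finset.HasAntidiagonal.antidiagonal (N + 1), u p
        = ∑ p ∈ Finset.HasAntidiagonal.antidiagonal N, u (p.1, p.2 + 1) := by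
      rw [Finset.Nat.sum_antidiagonal_succ']; simp [u]
    have hv : ∑ p ∈ Finset.HasAntidiagonal.antidiagonal (N + 1), v p
        = ∑ p ∈ Finset.HasAntidiagonal.antidiagonal N, v (p.1 + 1, p.2) := by
      rw [Finset.Nat.sum_antidiagonal_succ]; simp [v]
    have hR : (1 - q ^ (N + 1)) * ∑ p ∈ Finset.HasAntidiagonal.antidiagonal (N + 1),
        R p.1 * g p.1 * binomCoeff q c β p.1 p.2
        = ∑ p ∈ Finset.HasAntidiagonal.antidiagonal (N + 1), u p
          + ∑ p ∈ Finset.HasAntidiagonal.antidiagonal (N + 1), v p := by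
      rw [Finset.mul_sum, ← Finset.sum_add_distrib]
      refine Finset.sum_congr rfl fun p hp => ?_
      rw [← Finset.HasAntidiagonal.mem_antidiagonal.mp hp]
      rcases p with ⟨_ | k, _ | m⟩
      · simp [u, v]
      · simp only [u, v, zero_add]
        linear_combination (R 0 * g 0) * binomCoeff_succ hq c β 0 m
      · simp only [u, v, add_zero, binomCoeff_zero]
        ring
      · simp only [u, v]
        -- After multiplication by 1 - q^(m+1) the coefficients at (k+1, m+1) and (k, m+1) both
        -- become multiples of the one at (k+1, m).
        refine mul_left_cancel₀ (one_sub_pow_ne_zero hq m) ?_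
        linear_combination
          (R (k + 1) * g (k + 1) * (1 - q ^ (k + 1 + (m + 1)))) * binomCoeff_succ hq c β (k + 1) m
            - (R (k + 1) * g (k + 1) * q ^ (m + 1) * (1 - q ^ (k + 1)))
              * binomCoeff_succ' hq c β k m
    rw [hR, hu, hv, Finset.mul_sum, Finset.mul_sum, ← Finset.sum_add_distrib,
      ← Finset.sum_add_distrib]
    refine Finset.sum_congr rfl fun p hp => ?_
    have e1 := newtonDiff_pochRatio_mul (a := a) (X := X) hq p.1
    have e2 := hg' p.1
    have e3 := hg p.1
    rw [← Finset.HasAntidiagonal.mem_antidiagonal.mp hp]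
    simp only [u, v]
    change _ = q ^ p.1 * R p.1 + (1 - q ^ (p.1 + 1)) * R (p.1 + 1) at e1
    linear_combination ((γ - β) * q ^ (p.1 + p.2) * c
        * (c ^ p.1 * ∏ i ∈ Finset.range p.1, (γ / q - β * q ^ i)) * binomCoeff q c β p.1 p.2) * e1
      + (q ^ p.2 * (q ^ p.1 * R p.1 + (1 - q ^ (p.1 + 1)) * R (p.1 + 1))
          * binomCoeff q c β p.1 p.2) * e2
      + q ^ p.2 * q ^ p.1 * R p.1 * binomCoeff q c β p.1 p.2 * e3

/-- For β = 0 the coefficients `binomCoeff` vanish unless the second index is 0, so a single divided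
difference survives. -/
theorem milneSum_zero_one (hq0 : q ≠ 0) (hq : ‖q‖ < 1) (ha : ∀ i, a i ≠ 0) (hX : IsGeneric q X)
    (N : ℕ) :
    milneSum q a X 0 1 N = (∏ i, a i) ^ N * newtonDiff q N (pochRatio q a X) 0 := by
  rw [milneSum_eq hq0 hq ha hX, Finset.sum_eq_single (N, 0)]
  · simp [mul_comm]
  · rintro ⟨k, m⟩ hp hne
    have hm : m ≠ 0 := by
      rintro rfl
      simp at hp
      simp [hp] at hne
    simp [binomCoeff, hm]
  · simp

/-- The `q`-Chu--Vandermonde sum, as a formula for a divided difference. -/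
theorem newtonDiff_div (hq0 : q ≠ 0) (hq : ‖q‖ < 1) {b Y : ℂ} (hb : b ≠ 0) (hY0 : Y ≠ 0)
    (hY : ∀ n : ℕ, Y * q ^ n ≠ 1) (N : ℕ) :
    b ^ N * newtonDiff q N (fun n => qPoch q (Y / b) n / qPoch q Y n) 0
      = qPoch q b N / qPoch q q N * ((∏ k ∈ Finset.range N, (-(Y * q ^ k))) / qPoch q Y N) := by
  have h := milneSum_zero_one (a := fun _ : Fin 1 => b) (X := fun _ => Y) hq0 hq (fun _ => hb)
    ⟨fun _ => hY0, fun _ => hY, fun i j hij => absurd (Subsingleton.elim i j) hij⟩ N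
  have h1 : pochRatio q (fun _ : Fin 1 => b) (fun _ => Y)
      = fun n => qPoch q (Y / b) n / qPoch q Y n := by
    funext n; simp [pochRatio]
  have h2 : Finset.piAntidiag (Finset.univ : Finset (Fin 1)) N = {fun _ => N} := by
    ext l
    simp only [Finset.mem_piAntidiag, Finset.univ_unique, Finset.sum_singleton, Fin.default_eq_zero,
      Finset.mem_singleton]
    constructor
    · rintro ⟨h, -⟩
      funext i
      rw [Subsingleton.elim i 0, h]
    · rintro rfl
      exact ⟨rfl, fun i _ => Subsingleton.elim _ _⟩
  rw [h1] at h
  simp only [Finset.univ_unique, Finset.prod_singleton] at h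
  rw [← h, milneSum, h2, Finset.sum_singleton]
  simp [milneTerm, milneFactor, vdm, hY0]

end

section

/-! ### Infinite products -/

variable {M : ℕ} {q : ℂ}

theorem tendsto_qPoch (hq : ‖q‖ < 1) (a : ℂ) :
    Filter.Tendsto (qPoch q a) Filter.atTop (nhds (qInf q a)) :=
  (multipliable_qInf hq a).hasProd.tendsto_prod_nat

theorem qInf_eq_mul (hq : ‖q‖ < 1) (a : ℂ) : qInf q a = (1 - a) * qInf q (q * a) := by
  refine tendsto_nhds_unique ((tendsto_qPoch hq a).comp (Filter.tendsto_add_atTop_nat 1)) ?_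
  refine ((tendsto_qPoch hq (q * a)).const_mul (1 - a)).congr fun n => ?_
  exact (qPoch_succ' q a n).symm

theorem qInf_eq_qPoch_mul (hq : ‖q‖ < 1) (a : ℂ) (n : ℕ) :
    qInf q a = qPoch q a n * qInf q (q ^ n * a) := by
  induction n with
  | zero => simp
  | succ n ih =>
    rw [ih, qInf_eq_mul hq (q ^ n * a), qPoch_succ, pow_succ', mul_comm a, mul_assoc q, mul_assoc]

theorem qInf_ne_zero (hq : ‖q‖ < 1) {a : ℂ} (h : ∀ n : ℕ, a * q ^ n ≠ 1) : qInf q a ≠ 0 := by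
  have := tprod_one_add_ne_zero_of_summable (f := fun n : ℕ => -(a * q ^ n))
    (fun n => by rw [← sub_eq_add_neg]; exact sub_ne_zero.mpr (h n).symm)
    (by simpa [norm_mul, norm_pow] using
      (summable_geometric_of_lt_one (norm_nonneg q) hq).mul_left ‖a‖)
  simpa [qInf, sub_eq_add_neg] using this

/-! ### Newton series solve the system -/

/-- `∏_i (B_i x_i)_∞ / (x_i)_∞`. -/
noncomputable def weight (q : ℂ) (B : Fin M → ℂ) (x : Fin M → ℂ) : ℂ :=
  ∏ i, qInf q (B i * x i) / qInf q (x i)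

/-- The values of the weight at `x, q x, q² x, …`. -/
noncomputable def weightSeq (q : ℂ) (B : Fin M → ℂ) (x : Fin M → ℂ) (n : ℕ) : ℂ :=
  weight q B fun i => q ^ n * x i

variable {B x : Fin M → ℂ}

theorem isGeneric_of_mem_regularSet (hB : ∀ i, B i ≠ 0) (hx : x ∈ regularSet q B) :
    IsGeneric q fun i => B i * x i :=
  ⟨fun i => mul_ne_zero (hB i) (hx.1 i), hx.2.2.1, hx.2.2.2⟩

theorem scale_mem_regularSet (hq0 : q ≠ 0) (hx : x ∈ regularSet q B) :
    (fun i => q * x i) ∈ regularSet q B := by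
  refine ⟨fun i => mul_ne_zero hq0 (hx.1 i), fun i n => ?_, fun i n => ?_, fun i j hij n => ?_⟩
  · have := hx.2.1 i (n + 1)
    rwa [pow_succ', ← mul_assoc, mul_comm (x i)] at this
  · have := hx.2.2.1 i (n + 1)
    rwa [show B i * x i * q ^ (n + 1) = B i * (q * x i) * q ^ n by ring] at this
  · intro e
    refine hx.2.2.2 i j hij n (mul_left_cancel₀ hq0 ?_)
    linear_combination e

theorem scale_pow_mem_regularSet (hq0 : q ≠ 0) (hx : x ∈ regularSet q B) (n : ℕ) :
    (fun i => q ^ n * x i) ∈ regularSet q B := by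
  induction n with
  | zero => simpa using hx
  | succ n ih =>
    have := scale_mem_regularSet hq0 ih
    simpa only [← mul_assoc, ← pow_succ'] using this

theorem update_mem_regularSet (hq0 : q ≠ 0) (hx : x ∈ regularSet q B) (k : Fin M) :
    Function.update x k (q * x k) ∈ regularSet q B := by
  have key : ∀ i, ∃ m : ℕ, m ≤ 1 ∧ (i ≠ k → m = 0) ∧
      Function.update x k (q * x k) i = q ^ m * x i := by
    intro i
    rcases eq_or_ne i k with rfl | h
    · exact ⟨1, le_rfl, fun h => absurd rfl h, by simp⟩
    · exact ⟨0, zero_le_one, fun _ => rfl, by simp [h]⟩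
  refine ⟨fun i => ?_, fun i n => ?_, fun i n => ?_, fun i j hij n => ?_⟩
  · obtain ⟨m, -, -, e⟩ := key i
    rw [e]
    exact mul_ne_zero (pow_ne_zero _ hq0) (hx.1 i)
  · obtain ⟨m, -, -, e⟩ := key i
    have := hx.2.1 i (n + m)
    rw [e]
    rwa [show x i * q ^ (n + m) = q ^ m * x i * q ^ n by ring] at this
  · obtain ⟨m, -, -, e⟩ := key i
    have := hx.2.2.1 i (n + m)
    rw [e]
    rwa [show B i * x i * q ^ (n + m) = B i * (q ^ m * x i) * q ^ n by ring] at this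
  · obtain ⟨m, hm, hm0, e⟩ := key i
    obtain ⟨m', hm', hm0', e'⟩ := key j
    rw [e, e']
    intro h
    rcases Nat.eq_zero_or_pos m' with rfl | hp
    · refine hx.2.2.2 i j hij (n + m) ?_
      linear_combination h
    · obtain rfl : m' = 1 := le_antisymm hm' hp
      have hj : j = k := by
        by_contra hj
        exact one_ne_zero (hm0' hj)
      obtain rfl := hm0 (hj ▸ hij)
      -- Here x_j is the shifted variable, so the relation to exclude is B_i x_i q^n = q B_j x_j.
      -- For n = 0 it is the condition for (j, i) with exponent 1; for larger n a factor q cancels.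
      rcases n with _ | n
      · refine hx.2.2.2 j i hij.symm 1 ?_
        linear_combination -h
      · refine hx.2.2.2 i j hij n (mul_left_cancel₀ hq0 ?_)
        linear_combination h

/-- From (a)_∞ = (1 - a)(qa)_∞ one gets (1 - x_i) W = (1 - B_i x_i) T_i W, which rearranges to (1 -
T_i) W = x_i (1 - B_i T_i) W. -/
theorem weight_update (hq : ‖q‖ < 1) (hx : x ∈ regularSet q B) (i : Fin M) :
    weight q B x - weight q B (Function.update x i (q * x i))
      = x i * (weight q B x - B i * weight q B (Function.update x i (q * x i))) := by
  have h1 : weight q B (Function.update x i (q * x i))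
      = qInf q (q * (B i * x i)) / qInf q (q * x i)
        * ∏ j ∈ Finset.univ.erase i, qInf q (B j * x j) / qInf q (x j) := by
    rw [weight, ← Finset.mul_prod_erase _ _ (Finset.mem_univ i)]
    congr 1
    · rw [Function.update_self, mul_left_comm]
    · exact Finset.prod_congr rfl fun j hj => by
        rw [Function.update_of_ne (Finset.ne_of_mem_erase hj)]
  have h2 : weight q B x = qInf q (B i * x i) / qInf q (x i)
        * ∏ j ∈ Finset.univ.erase i, qInf q (B j * x j) / qInf q (x j) :=
    (Finset.mul_prod_erase _ _ (Finset.mem_univ i)).symm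
  have h3 : 1 - x i ≠ 0 := sub_ne_zero.mpr (by simpa using (hx.2.1 i 0).symm)
  have h4 : qInf q (q * x i) ≠ 0 := by
    have := qInf_ne_zero hq (hx.2.1 i)
    rw [qInf_eq_mul hq] at this
    exact right_ne_zero_of_mul this
  rw [h1, h2, qInf_eq_mul hq (B i * x i), qInf_eq_mul hq (x i)]
  field_simp
  ring

theorem weightSeq_eq (hq : ‖q‖ < 1) (hB : ∀ i, B i ≠ 0) (hx : x ∈ regularSet q B) (n : ℕ) :
    weightSeq q B x n = weight q B x * pochRatio q B (fun i => B i * x i) n := by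
  rw [weightSeq, weight, weight, pochRatio, ← Finset.prod_mul_distrib]
  refine Finset.prod_congr rfl fun i _ => ?_
  have h1 := qInf_ne_zero hq (hx.2.1 i)
  have h2 := qPoch_ne_zero (hx.2.2.1 i) n
  rw [mul_div_cancel_left₀ _ (hB i), mul_left_comm, qInf_eq_qPoch_mul hq (B i * x i) n]
  rw [qInf_eq_qPoch_mul hq (x i) n] at h1 ⊢
  have h3 := left_ne_zero_of_mul h1
  have h4 := right_ne_zero_of_mul h1
  field_simp

theorem newtonDiff_weightSeq (hq : ‖q‖ < 1) (hB : ∀ i, B i ≠ 0) (hx : x ∈ regularSet q B)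
    (N : ℕ) :
    newtonDiff q N (weightSeq q B x) 0
      = weight q B x * newtonDiff q N (pochRatio q B fun i => B i * x i) 0 := by
  rw [← newtonDiff_const_mul]
  exact congrArg (fun f => newtonDiff q N f 0) (funext (weightSeq_eq hq hB hx))

theorem newtonDiff_weightSeq_scale (hq : ‖q‖ < 1) (N : ℕ) :
    newtonDiff q N (weightSeq q B fun i => q * x i) 0 = newtonDiff q N (weightSeq q B x) 1 := by
  have h : (weightSeq q B fun i => q * x i) = fun n => weightSeq q B x (n + 1) := by
    funext n
    simp only [weightSeq, pow_succ, mul_assoc]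
  rw [h]
  exact newtonDiff_shift hq 1 N _ 0

theorem weightSeq_update (hq0 : q ≠ 0) (hq : ‖q‖ < 1) (hx : x ∈ regularSet q B) (i : Fin M)
    (n : ℕ) :
    weightSeq q B x n - weightSeq q B (Function.update x i (q * x i)) n
      = q ^ n * (x i * (weightSeq q B x n
          - B i * weightSeq q B (Function.update x i (q * x i)) n)) := by
  have h := weight_update hq (scale_pow_mem_regularSet hq0 hx n) i
  have e : Function.update (fun j => q ^ n * x j) i (q * (q ^ n * x i))
      = fun j => q ^ n * Function.update x i (q * x i) j := by
    funext j
    rcases eq_or_ne j i with rfl | hj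
    · simp; ring
    · simp [hj]
  rw [e] at h
  rw [weightSeq, weightSeq, h]
  ring

theorem mixed_op_apply (i j : Fin M) (b : ℂ) (z : (Fin M → ℂ) → ℂ) (x : Fin M → ℂ) :
    ((1 - qShift q j) * (1 - b • qShift q i) : Op M) z x
      = z x - b * z (Function.update x i (q * x i))
        - (z (Function.update x j (q * x j))
          - b * z (Function.update (Function.update x j (q * x j)) i
              (q * Function.update x j (q * x j) i))) := by
  simp [Module.End.mul_apply, qShift_apply]

theorem first_op_apply (i : Fin M) (c : ℂ) (z : (Fin M → ℂ) → ℂ) (x : Fin M → ℂ) :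
    ((1 - qShift q i) * (1 - c • qShiftAll q) : Op M) z x
      = z x - c * z (fun k => q * x k)
        - (z (Function.update x i (q * x i))
          - c * z (fun k => q * Function.update x i (q * x i) k)) := by
  simp [Module.End.mul_apply, qShift_apply, qShiftAll_apply]

theorem second_op_apply (i : Fin M) (b c : ℂ) (z : (Fin M → ℂ) → ℂ) (x : Fin M → ℂ) :
    ((1 - b • qShift q i) * (1 - c • qShiftAll q) : Op M) z x
      = z x - c * z (fun k => q * x k)
        - b * (z (Function.update x i (q * x i))
          - c * z (fun k => q * Function.update x i (q * x i) k)) := by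
  simp [Module.End.mul_apply, qShift_apply, qShiftAll_apply]

theorem newtonDiff_comb (q c d : ℂ) (N : ℕ) (f g : ℕ → ℂ) (n : ℕ) :
    newtonDiff q N (fun m => c * (f m - d * g m)) n
      = c * (newtonDiff q N f n - d * newtonDiff q N g n) := by
  rw [newtonDiff_const_mul, newtonDiff_sub q N f fun m => d * g m, newtonDiff_const_mul]

/-- The partial sums of the second equation of the system telescope. -/
theorem sum_second_equation (hq0 : q ≠ 0) (hq : ‖q‖ < 1) {A C : ℂ} {c : ℕ → ℂ}
    (hc : ∀ N, c (N + 1) * (1 - C * q ^ N) = c N * (A - C * q ^ N)) {e g : ℕ → ℂ}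
    (he : ∀ n, e n = q ^ n * g n) (K : ℕ) :
    ∑ N ∈ Finset.range (K + 1), c N * (newtonDiff q N e 0 - C * q⁻¹ * newtonDiff q N e 1
        - (newtonDiff q N g 0 - A * newtonDiff q N g 1))
      = c K * (A - C * q ^ K) * newtonDiff q K g 1 := by
  obtain rfl : e = fun n => q ^ n * g n := funext he
  induction K with
  | zero =>
    simp
    field_simp
  | succ K ih =>
    -- In the new summand, the differences based at 0 combine by the Newton step into -D_K g (1).
    -- Its total coefficient -c_{K+1} (1 - C q^K) cancels the previous boundary term by the
    -- recurrence for c.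
    rw [Finset.sum_range_succ, ih, newtonDiff_pow_mul hq, newtonDiff_pow_mul hq]
    have h := newtonDiff_succ_eq hq K g 0
    rw [zero_add] at h
    have hqi : C * q⁻¹ * (q ^ (K + 1 + 1) * newtonDiff q (K + 1) g 1
        - q ^ (K + 1) * newtonDiff q K g 1)
        = C * (q ^ (K + 1) * newtonDiff q (K + 1) g 1 - q ^ K * newtonDiff q K g 1) := by
      field_simp
      ring
    rw [hqi]
    linear_combination (-newtonDiff q K g 1) * hc K + c (K + 1) * h

theorem isSolutionOn_of_hasSum (hq0 : q ≠ 0) (hq : ‖q‖ < 1) {A C : ℂ} {c : ℕ → ℂ}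
    (hc : ∀ N, c (N + 1) * (1 - C * q ^ N) = c N * (A - C * q ^ N)) {D : Set (Fin M → ℂ)}
    (hD : D ⊆ regularSet q B) (hD1 : ∀ x ∈ D, (fun i => q * x i) ∈ D)
    (hD2 : ∀ x ∈ D, ∀ i, Function.update x i (q * x i) ∈ D) {z : (Fin M → ℂ) → ℂ}
    (hz : ∀ x ∈ D, HasSum (fun N => c N * newtonDiff q N (weightSeq q B x) 0) (z x)) :
    IsSolutionOn q A B C D z := by
  intro x hx
  refine ⟨fun i j => ?_, fun i => ?_⟩
  · rw [mixed_op_apply, mixed_op_apply]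
    rcases eq_or_ne i j with rfl | hij
    · ring
    set xi := Function.update x i (q * x i) with hxi
    set xj := Function.update x j (q * x j) with hxj
    have eij : xj i = x i := Function.update_of_ne hij _ _
    have eji : xi j = x j := Function.update_of_ne hij.symm _ _
    set xij := Function.update xj i (q * xj i) with hxij
    have exij : Function.update xi j (q * xi j) = xij := by
      rw [hxij, eij, eji, hxi, hxj, Function.update_comm hij]
    rw [exij]
    have mi : xi ∈ D := hD2 x hx i
    have mj : xj ∈ D := hD2 x hx j
    have mij : xij ∈ D := hD2 xj mj i
    have hs := (((hz x hx).sub ((hz xi mi).mul_left (B i))).sub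
        ((hz xj mj).sub ((hz xij mij).mul_left (B i)))).mul_left (x i) |>.sub
      ((((hz x hx).sub ((hz xj mj).mul_left (B j))).sub
        ((hz xi mi).sub ((hz xij mij).mul_left (B j)))).mul_left (x j))
    refine hs.unique (hasSum_zero.congr_fun fun N => ?_)
    have z1 := newtonDiff_comb q (x i) (B i) N (weightSeq q B x) (weightSeq q B xi) 0
    have z2 := newtonDiff_comb q (x i) (B i) N (weightSeq q B xj) (weightSeq q B xij) 0
    have z3 := newtonDiff_comb q (x j) (B j) N (weightSeq q B x) (weightSeq q B xj) 0
    have z4 := newtonDiff_comb q (x j) (B j) N (weightSeq q B xi) (weightSeq q B xij) 0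
    have key : newtonDiff q N (fun m => (x i * (weightSeq q B x m - B i * weightSeq q B xi m)
          - x i * (weightSeq q B xj m - B i * weightSeq q B xij m))
        - (x j * (weightSeq q B x m - B j * weightSeq q B xj m)
          - x j * (weightSeq q B xi m - B j * weightSeq q B xij m))) 0 = 0 := by
      have : (fun m => (x i * (weightSeq q B x m - B i * weightSeq q B xi m)
          - x i * (weightSeq q B xj m - B i * weightSeq q B xij m))
        - (x j * (weightSeq q B x m - B j * weightSeq q B xj m)
          - x j * (weightSeq q B xi m - B j * weightSeq q B xij m))) = 0 := by
        funext m
        have w1 := weightSeq_update hq0 hq (hD hx) i m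
        have w2 := weightSeq_update hq0 hq (hD mj) i m
        have w3 := weightSeq_update hq0 hq (hD hx) j m
        have w4 := weightSeq_update hq0 hq (hD mi) j m
        rw [← hxi] at w1
        rw [← hxij, eij] at w2
        rw [← hxj] at w3
        rw [exij, eji] at w4
        -- Multiplied by q^m, both halves equal (1 - T_i)(1 - T_j) applied to W_m.
        refine mul_left_cancel₀ (pow_ne_zero m hq0) ?_
        simp only [Pi.zero_apply, mul_zero]
        linear_combination -w1 + w2 + w3 - w4
      rw [this, map_zero]; rfl
    rw [newtonDiff_sub q N (fun m => x i * (weightSeq q B x m - B i * weightSeq q B xi m)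
          - x i * (weightSeq q B xj m - B i * weightSeq q B xij m)) (fun m =>
          x j * (weightSeq q B x m - B j * weightSeq q B xj m)
          - x j * (weightSeq q B xi m - B j * weightSeq q B xij m)),
      newtonDiff_sub q N (fun m => x i * (weightSeq q B x m - B i * weightSeq q B xi m)),
      newtonDiff_sub q N (fun m => x j * (weightSeq q B x m - B j * weightSeq q B xj m)),
      z1, z2, z3, z4] at key
    linear_combination c N * key
  · rw [first_op_apply, second_op_apply]
    set xi := Function.update x i (q * x i) with hxi
    have mi : xi ∈ D := hD2 x hx i
    have h1 := hz _ (hD1 x hx)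
    have h2 := hz _ (hD1 xi mi)
    -- The simultaneous shift of all variables moves the base point of the divided difference from 0
    -- to 1.
    simp only [newtonDiff_weightSeq_scale hq] at h1 h2
    set e : ℕ → ℂ := fun n => weightSeq q B x n - weightSeq q B xi n
    set g : ℕ → ℂ := fun n => x i * (weightSeq q B x n - B i * weightSeq q B xi n)
    have he : ∀ n, e n = q ^ n * g n := weightSeq_update hq0 hq (hD hx) i
    have hE : ∀ N k, newtonDiff q N e k
        = newtonDiff q N (weightSeq q B x) k - newtonDiff q N (weightSeq q B xi) k :=
      fun N k => newtonDiff_sub q N _ _ k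
    have hG : ∀ N k, newtonDiff q N g k = x i * (newtonDiff q N (weightSeq q B x) k
        - B i * newtonDiff q N (weightSeq q B xi) k) :=
      fun N k => newtonDiff_comb q _ _ N _ _ k
    have hs := (((hz x hx).sub (h1.mul_left (C * q⁻¹))).sub
        ((hz xi mi).sub (h2.mul_left (C * q⁻¹)))).sub
      ((((hz x hx).sub (h1.mul_left A)).sub
        (((hz xi mi).sub (h2.mul_left A)).mul_left (B i))).mul_left (x i))
    -- The boundary term is A - C q^K, which converges, times a combination of the general terms of
    -- the convergent series for z at qx and at q T_i x.
    have hlim : Filter.Tendsto (fun K => c K * (A - C * q ^ K) * newtonDiff q K g 1)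
        Filter.atTop (nhds 0) := by
      have t1 : Filter.Tendsto (fun K : ℕ => A - C * q ^ K) Filter.atTop (nhds (A - C * 0)) :=
        ((tendsto_pow_atTop_nhds_zero_of_norm_lt_one hq).const_mul C).const_sub A
      have t2 := ((h1.summable.sub (h2.summable.mul_left (B i))).mul_left (x i)).tendsto_atTop_zero
      have t3 := t1.mul t2
      rw [mul_zero] at t3
      refine t3.congr fun K => ?_
      rw [hG]; ring
    have hpart := hs.tendsto_sum_nat.comp (Filter.tendsto_add_atTop_nat 1)
    refine tendsto_nhds_unique hpart (hlim.congr fun K => ?_)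
    rw [← sum_second_equation hq0 hq hc he K]
    refine Finset.sum_congr rfl fun N _ => ?_
    rw [hE, hE, hG, hG]
    ring

end

section

/-! ### Bounded functions and summability -/

/-- A function with bounded values. -/
def BoundedFun {ι : Type*} (f : ι → ℂ) : Prop := ∃ K : ℝ, ∀ i, ‖f i‖ ≤ K

namespace BoundedFun

variable {ι κ : Type*} {f g : ι → ℂ}

theorem const (c : ℂ) : BoundedFun fun _ : ι => c := ⟨‖c‖, fun _ => le_rfl⟩

theorem mul (hf : BoundedFun f) (hg : BoundedFun g) : BoundedFun fun i => f i * g i := by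
  obtain ⟨K, hK⟩ := hf
  obtain ⟨L, hL⟩ := hg
  refine ⟨K * L, fun i => ?_⟩
  rw [norm_mul]
  exact mul_le_mul (hK i) (hL i) (norm_nonneg _) ((norm_nonneg _).trans (hK i))

theorem sub (hf : BoundedFun f) (hg : BoundedFun g) : BoundedFun fun i => f i - g i := by
  obtain ⟨K, hK⟩ := hf
  obtain ⟨L, hL⟩ := hg
  exact ⟨K + L, fun i => (norm_sub_le _ _).trans (add_le_add (hK i) (hL i))⟩

theorem prod {s : Finset κ} {F : κ → ι → ℂ} (h : ∀ k, BoundedFun (F k)) :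
    BoundedFun fun i => ∏ k ∈ s, F k i := by
  classical
  induction s using Finset.induction_on with
  | empty => simpa using const 1
  | insert a s ha ih =>
    simp only [Finset.prod_insert ha]
    exact (h a).mul ih

theorem comp (hf : BoundedFun f) (e : κ → ι) : BoundedFun fun k => f (e k) := by
  obtain ⟨K, hK⟩ := hf
  exact ⟨K, fun k => hK (e k)⟩

theorem of_tendsto {f : ℕ → ℂ} {c : ℂ} (h : Filter.Tendsto f Filter.atTop (nhds c)) :
    BoundedFun f := by
  obtain ⟨K, hK⟩ := (Metric.isBounded_range_of_tendsto f h).exists_norm_le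
  exact ⟨K, fun n => hK _ ⟨n, rfl⟩⟩

theorem summable_mul (hf : BoundedFun f) (hg : Summable g) : Summable fun i => f i * g i := by
  obtain ⟨K, hK⟩ := hf
  refine Summable.of_norm_bounded (hg.norm.mul_left K) fun i => ?_
  rw [norm_mul]
  exact mul_le_mul_of_nonneg_right (hK i) (norm_nonneg _)

end BoundedFun

variable {M : ℕ} {q : ℂ}

theorem boundedFun_pow (hq : ‖q‖ < 1) : BoundedFun fun n : ℕ => q ^ n :=
  BoundedFun.of_tendsto (tendsto_pow_atTop_nhds_zero_of_norm_lt_one hq)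

theorem boundedFun_qPoch (hq : ‖q‖ < 1) (a : ℂ) : BoundedFun (qPoch q a) :=
  BoundedFun.of_tendsto (tendsto_qPoch hq a)

theorem boundedFun_inv_qPoch (hq : ‖q‖ < 1) {a : ℂ} (h : ∀ n : ℕ, a * q ^ n ≠ 1) :
    BoundedFun fun n => (qPoch q a n)⁻¹ :=
  BoundedFun.of_tendsto ((tendsto_qPoch hq a).inv₀ (qInf_ne_zero hq h))

/-- The bound has to be uniform in both the shift and the length, since both vary in the double
series and in the finite form of the first series. -/
theorem boundedFun_qPoch_shift (hq : ‖q‖ < 1) (a : ℂ) :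
    BoundedFun fun p : ℕ × ℕ => qPoch q (a * q ^ p.1) p.2 := by
  have hs := summable_geometric_of_lt_one (norm_nonneg q) hq
  -- Each factor is at most 1 + |a||q|^i ≤ exp(|a||q|^i), and the exponents are bounded by a
  -- geometric series.
  refine ⟨Real.exp (‖a‖ * (1 - ‖q‖)⁻¹), fun p => ?_⟩
  simp only [qPoch, norm_prod]
  have h1 : ∀ i ∈ Finset.range p.2, ‖1 - a * q ^ p.1 * q ^ i‖ ≤ Real.exp (‖a‖ * ‖q‖ ^ i) := by
    intro i _
    refine (norm_sub_le _ _).trans ?_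
    rw [norm_one, norm_mul, norm_mul, norm_pow, norm_pow, add_comm]
    refine le_trans ?_ (Real.add_one_le_exp _)
    gcongr
    exact mul_le_of_le_one_right (norm_nonneg _) (pow_le_one₀ (norm_nonneg _) hq.le)
  refine (Finset.prod_le_prod (fun _ _ => norm_nonneg _) h1).trans ?_
  rw [← Real.exp_sum, Real.exp_le_exp, ← Finset.mul_sum, ← tsum_geometric_of_lt_one (norm_nonneg q) hq]
  exact mul_le_mul_of_nonneg_left (hs.sum_le_tsum _ fun _ _ => by positivity) (norm_nonneg _)

theorem summable_prod_apply {g : Fin M → ℕ → ℝ} (h0 : ∀ i n, 0 ≤ g i n)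
    (hg : ∀ i, Summable (g i)) : Summable fun l : Fin M → ℕ => ∏ i, g i (l i) := by
  induction M with
  | zero => exact Summable.of_finite
  | succ M ih =>
    have h := Summable.mul_of_nonneg (hg 0) (ih (fun i => h0 i.succ) fun i => hg i.succ) (h0 0)
      fun l => Finset.prod_nonneg fun i _ => h0 i.succ (l i)
    rw [← (Fin.consEquiv fun _ : Fin (M + 1) => ℕ).summable_iff]
    refine h.congr fun p => ?_
    simp [Fin.prod_univ_succ, Fin.consEquiv]

theorem summable_pow_mul_pow_choose {L r : ℝ} (hr0 : 0 < r) (hr : r < 1) :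
    Summable fun n : ℕ => L ^ n * r ^ n.choose 2 := by
  rcases eq_or_ne L 0 with rfl | hL
  · refine summable_of_ne_finset_zero (s := {0}) fun n hn => ?_
    rw [zero_pow (by simpa using hn), zero_mul]
  refine summable_of_ratio_test_tendsto_lt_one (l := 0) zero_lt_one
    (Filter.Eventually.of_forall fun n => by positivity) ?_
  have h := (tendsto_pow_atTop_nhds_zero_of_lt_one hr0.le hr).const_mul |L|
  rw [mul_zero] at h
  refine h.congr fun n => ?_
  have hc : (n + 1).choose 2 = n.choose 2 + n := by
    rw [Nat.choose_succ_succ' n 1, Nat.choose_one_right, add_comm]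
  rw [← norm_div, hc, pow_add r, pow_succ L]
  rw [show L ^ n * L * (r ^ n.choose 2 * r ^ n) / (L ^ n * r ^ n.choose 2) = L * r ^ n by
    field_simp]
  rw [norm_mul, norm_pow, Real.norm_eq_abs, Real.norm_eq_abs, abs_of_pos hr0]

theorem hasSum_piAntidiag {f : (Fin M → ℕ) → ℂ} (hf : Summable f) :
    HasSum (fun N => ∑ l ∈ Finset.piAntidiag Finset.univ N, f l) (∑' l, f l) := by
  have h := (Equiv.sigmaFiberEquiv fun l : Fin M → ℕ => ∑ i, l i).hasSum_iff.mpr hf.hasSum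
  refine h.sigma fun N => ?_
  have e : ∀ l : Fin M → ℕ, l ∈ Finset.piAntidiag Finset.univ N ↔ ∑ i, l i = N := by
    intro l; simp
  have h2 := (Finset.piAntidiag (Finset.univ : Finset (Fin M)) N).hasSum f
  exact (Equiv.subtypeEquivRight e).symm.hasSum_iff.mpr h2

theorem prod_range_neg_mul_pow (X : ℂ) (n : ℕ) :
    ∏ k ∈ Finset.range n, (-(X * q ^ k)) = (-X) ^ n * q ^ n.choose 2 := by
  induction n with
  | zero => simp
  | succ n ih =>
    rw [Finset.prod_range_succ, ih, Nat.choose_succ_succ' n 1, Nat.choose_one_right, pow_add,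
      pow_succ]
    ring

variable {a X : Fin M → ℂ}

/-- The part of the summand of a Milne type sum which does not depend on `β` and `γ`. -/
noncomputable def milneCore (q : ℂ) (a X : Fin M → ℂ) (l : Fin M → ℕ) : ℂ :=
  vdm (fun i => X i * q ^ l i) / vdm X
    * ∏ i, (∏ j, qPoch q (a j * X i / X j) (l i)) / (∏ j, qPoch q (q * X i / X j) (l i))
      / qPoch q (X i) (l i)

theorem milneTerm_eq_core (β γ : ℂ) (l : Fin M → ℕ) :
    milneTerm q a X β γ l
      = milneCore q a X l * ∏ i, ∏ k ∈ Finset.range (l i), (β - γ * X i * q ^ k) := by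
  rw [milneTerm, milneCore, mul_assoc, ← Finset.prod_mul_distrib]
  congr 1
  exact Finset.prod_congr rfl fun i _ => by rw [milneFactor]; ring

/-- All factors are continuous expressions in sequences with finite limits, the denominators having
nonzero limits. Summability is therefore decided by ∏ (β - γ X_i q^k) alone: for (0, 1) it decays
like q^{l(l-1)/2} and beats any geometric factor; for β = 1 it is merely bounded and a ratio of
modulus less than 1 is needed. -/
theorem boundedFun_milneCore (hq : ‖q‖ < 1) (hX : IsGeneric q X) :
    BoundedFun (milneCore q a X) := by
  have h1 : BoundedFun fun l : Fin M → ℕ => vdm (fun i => X i * q ^ l i) := by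
    refine BoundedFun.prod fun i => BoundedFun.prod fun j => ?_
    exact ((BoundedFun.const _).mul ((boundedFun_pow hq).comp fun l : Fin M → ℕ => l i)).sub
      ((BoundedFun.const _).mul ((boundedFun_pow hq).comp fun l : Fin M → ℕ => l j))
  have h2 : ∀ i, BoundedFun fun l : Fin M → ℕ =>
      (∏ j, qPoch q (a j * X i / X j) (l i)) * (∏ j, (qPoch q (q * X i / X j) (l i))⁻¹)
        * (qPoch q (X i) (l i))⁻¹ := by
    intro i
    refine ((BoundedFun.prod fun j => ?_).mul (BoundedFun.prod fun j => ?_)).mul ?_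
    · exact (boundedFun_qPoch hq _).comp fun l : Fin M → ℕ => l i
    · exact (boundedFun_inv_qPoch hq (hX.mul_div_mul_pow_ne_one hq i j)).comp
        fun l : Fin M → ℕ => l i
    · exact (boundedFun_inv_qPoch hq (hX.2.1 i)).comp fun l : Fin M → ℕ => l i
  have h3 := (h1.mul (BoundedFun.const (vdm X)⁻¹)).mul (BoundedFun.prod (s := Finset.univ) h2)
  convert h3 using 2 with l
  simp only [milneCore, div_eq_mul_inv, Finset.prod_inv_distrib]

theorem summable_pow_mul_milneTerm (hq0 : q ≠ 0) (hq : ‖q‖ < 1) (hX : IsGeneric q X) (L : ℂ) :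
    Summable fun l : Fin M → ℕ => L ^ (∑ i, l i) * milneTerm q a X 0 1 l := by
  have h1 : Summable fun l : Fin M → ℕ =>
      ∏ i, ((L * -X i) ^ l i * q ^ (l i).choose 2) := by
    refine Summable.of_norm ?_
    simp only [norm_prod, norm_mul, norm_pow]
    refine summable_prod_apply (g := fun i n => (‖L‖ * ‖-X i‖) ^ n * ‖q‖ ^ n.choose 2)
      (fun i n => by positivity) fun i => ?_
    exact summable_pow_mul_pow_choose (norm_pos_iff.mpr hq0) hq
  refine ((boundedFun_milneCore (a := a) hq hX).summable_mul h1).congr fun l => ?_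
  rw [milneTerm_eq_core, ← Finset.prod_pow_eq_pow_sum, mul_left_comm, ← Finset.prod_mul_distrib]
  congr 1
  refine Finset.prod_congr rfl fun i _ => ?_
  simp only [zero_sub, one_mul]
  rw [prod_range_neg_mul_pow, mul_pow, mul_assoc]

theorem summable_pow_mul_milneTerm_one (hq : ‖q‖ < 1) (hX : IsGeneric q X) (γ : ℂ) {u : ℂ}
    (hu : ‖u‖ < 1) :
    Summable fun l : Fin M → ℕ => u ^ (∑ i, l i) * milneTerm q a X 1 γ l := by
  have h1 : Summable fun l : Fin M → ℕ => ∏ i, u ^ l i := by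
    refine Summable.of_norm ?_
    simp only [norm_prod, norm_pow]
    exact summable_prod_apply (g := fun _ n => ‖u‖ ^ n) (fun i n => by positivity)
      fun i => summable_geometric_of_lt_one (norm_nonneg u) hu
  have h2 : BoundedFun fun l : Fin M → ℕ => ∏ i, qPoch q (γ * X i) (l i) :=
    BoundedFun.prod fun i => (boundedFun_qPoch hq _).comp fun l : Fin M → ℕ => l i
  refine (((boundedFun_milneCore (a := a) hq hX).mul h2).summable_mul h1).congr fun l => ?_
  rw [milneTerm_eq_core, ← Finset.prod_pow_eq_pow_sum, mul_comm]
  simp only [qPoch]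

/-- Grouping the absolutely convergent multiple series by |l| and evaluating each group gives a
Newton series. The bounded weight s and the geometric factor L are free, to accommodate different
coefficients c_N. -/
theorem milneSum_hasSum_zero_one (hq0 : q ≠ 0) (hq : ‖q‖ < 1) (ha : ∀ i, a i ≠ 0)
    (hX : IsGeneric q X) {s : ℕ → ℂ} {L : ℂ} (hs : BoundedFun s) :
    HasSum (fun N => s N * L ^ N * newtonDiff q N (pochRatio q a X) 0)
      (∑' l : Fin M → ℕ, s (∑ i, l i) * ((L / ∏ i, a i) ^ (∑ i, l i) * milneTerm q a X 0 1 l)) := by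
  have h := hasSum_piAntidiag ((hs.comp fun l : Fin M → ℕ => ∑ i, l i).summable_mul
    (summable_pow_mul_milneTerm (a := a) hq0 hq hX (L / ∏ i, a i)))
  refine h.congr_fun fun N => ?_
  have hp : ∏ i, a i ≠ 0 := Finset.prod_ne_zero_iff.mpr fun i _ => ha i
  have e : newtonDiff q N (pochRatio q a X) 0
      = ((∏ i, a i) ^ N)⁻¹ * milneSum q a X 0 1 N := by
    rw [milneSum_zero_one hq0 hq ha hX]
    field_simp
  rw [e, milneSum, Finset.mul_sum, Finset.mul_sum]
  refine Finset.sum_congr rfl fun l hl => ?_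
  rw [(Finset.mem_piAntidiag.mp hl).1, div_pow]
  ring

end

section

/-! ### The second and the third solution -/

variable {M : ℕ} {q : ℂ} {B x : Fin M → ℂ}

/-- `∏_{i < N} (A - C q^i)`. -/
noncomputable def newtonCoeff (q A C : ℂ) (N : ℕ) : ℂ := ∏ i ∈ Finset.range N, (A - C * q ^ i)

theorem newtonCoeff_succ (q A C : ℂ) (N : ℕ) :
    newtonCoeff q A C (N + 1) = newtonCoeff q A C N * (A - C * q ^ N) :=
  Finset.prod_range_succ _ _

theorem newtonCoeff_eq {A : ℂ} (hA : A ≠ 0) (q C : ℂ) (N : ℕ) :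
    newtonCoeff q A C N = qPoch q (C / A) N * A ^ N := by
  rw [newtonCoeff, qPoch, Finset.pow_eq_prod_const, ← Finset.prod_mul_distrib]
  refine Finset.prod_congr rfl fun i _ => ?_
  field_simp

/-- A bound valid also for A = 0, where the coefficient is not of the form (C/A)_N A^N. -/
theorem boundedFun_newtonCoeff (hq : ‖q‖ < 1) (A C : ℂ) :
    ∃ L : ℂ, L ≠ 0 ∧ BoundedFun fun N => newtonCoeff q A C N / L ^ N := by
  have hL : 0 < ‖A‖ + ‖C‖ + 1 := by positivity
  -- Each factor A - C q^i has modulus at most |A| + |C|; the added 1 keeps L nonzero when A = C =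
  -- 0.
  refine ⟨((‖A‖ + ‖C‖ + 1 : ℝ) : ℂ), by exact_mod_cast hL.ne', 1, fun N => ?_⟩
  rw [norm_div, norm_pow, Complex.norm_real, Real.norm_of_nonneg hL.le,
    div_le_one (pow_pos hL _), newtonCoeff, norm_prod, Finset.pow_eq_prod_const]
  refine Finset.prod_le_prod (fun _ _ => norm_nonneg _) fun i _ => ?_
  refine (norm_sub_le _ _).trans ?_
  rw [norm_mul, norm_pow]
  have := mul_le_of_le_one_right (norm_nonneg C) (pow_le_one₀ (norm_nonneg q) hq.le (n := i))
  linarith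

theorem milneCore_mul (hB : ∀ i, B i ≠ 0) (l : Fin M → ℕ) :
    milneCore q B (fun i => B i * x i) l
      = vdm (fun i => B i * x i * q ^ l i) / vdm (fun i => B i * x i)
        * ∏ i, (∏ j, qPoch q (B i * x i / x j) (l i))
          / ((∏ j, qPoch q (q * (B i * x i) / (B j * x j)) (l i)) * qPoch q (B i * x i) (l i)) := by
  rw [milneCore]
  congr 1
  refine Finset.prod_congr rfl fun i _ => ?_
  rw [div_div]
  congr 1
  exact Finset.prod_congr rfl fun j _ => by rw [mul_div_mul_left _ _ (hB j)]

theorem milneTerm_zero_one_eq (X : Fin M → ℂ) (l : Fin M → ℕ) :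
    milneTerm q B X 0 1 l
      = (-1) ^ (∑ i, l i) * (milneCore q B X l * ∏ i, (X i ^ l i * q ^ (l i).choose 2)) := by
  rw [milneTerm_eq_core, ← Finset.prod_pow_eq_pow_sum, mul_left_comm, ← Finset.prod_mul_distrib]
  congr 1
  refine Finset.prod_congr rfl fun i _ => ?_
  simp only [zero_sub, one_mul]
  rw [prod_range_neg_mul_pow, neg_pow, mul_assoc]

theorem term3_eq (hB : ∀ i, B i ≠ 0) (A C : ℂ) (l : Fin M → ℕ) :
    term3 q A B C x l = qPoch q (C / A) (∑ i, l i) / qPoch q C (∑ i, l i)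
      * ((A / ∏ j, B j) ^ (∑ i, l i) * milneTerm q B (fun i => B i * x i) 0 1 l) := by
  have h : (-(A / ∏ j, B j)) ^ (∑ i, l i) = (A / ∏ j, B j) ^ (∑ i, l i) * (-1) ^ (∑ i, l i) := by
    rw [← mul_pow, mul_neg_one]
  rw [milneTerm_zero_one_eq, milneCore_mul hB, mul_assoc (_ / _) (∏ i, _ / _),
    ← Finset.prod_mul_distrib, term3, h]
  have h2 : ∀ i, (((∏ j, qPoch q (B i * x i / x j) (l i)) * (B i * x i) ^ l i * q ^ (l i).choose 2)
        / ((∏ j, qPoch q (q * (B i * x i) / (B j * x j)) (l i)) * qPoch q (B i * x i) (l i)))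
      = (∏ j, qPoch q (B i * x i / x j) (l i))
          / ((∏ j, qPoch q (q * (B i * x i) / (B j * x j)) (l i)) * qPoch q (B i * x i) (l i))
        * ((B i * x i) ^ l i * q ^ (l i).choose 2) := fun i => by ring
  simp only [h2]
  ring

theorem term2_eq (hB : ∀ i, B i ≠ 0) (A C : ℂ) (l : Fin M → ℕ) :
    term2 q A B C x l = (C / ∏ j, B j) ^ (∑ i, l i)
      * milneTerm q B (fun i => B i * x i) 1 (A / C) l := by
  rw [milneTerm_eq_core, milneCore_mul hB, mul_assoc (_ / _) (∏ i, _ / _),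
    ← Finset.prod_mul_distrib, term2, mul_assoc]
  congr 2
  refine Finset.prod_congr rfl fun i _ => ?_
  have : qPoch q (A * B i * x i / C) (l i)
      = ∏ k ∈ Finset.range (l i), (1 - A / C * (B i * x i) * q ^ k) :=
    Finset.prod_congr rfl fun k _ => by ring
  rw [this]
  ring

theorem boundedFun_qPoch_div (hq : ‖q‖ < 1) {C : ℂ} (hC : ∀ n : ℕ, C * q ^ n ≠ 1) (a : ℂ) :
    BoundedFun fun n => qPoch q a n / qPoch q C n :=
  (boundedFun_qPoch hq a).mul (boundedFun_inv_qPoch hq hC)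

theorem summable_term3 (hq0 : q ≠ 0) (hq : ‖q‖ < 1) (hB : ∀ i, B i ≠ 0) {A C : ℂ}
    (hC : ∀ n : ℕ, C * q ^ n ≠ 1) (hx : x ∈ regularSet q B) : Summable (term3 q A B C x) := by
  refine (((boundedFun_qPoch_div hq hC (C / A)).comp fun l : Fin M → ℕ => ∑ i, l i).summable_mul
    (summable_pow_mul_milneTerm (a := B) hq0 hq (isGeneric_of_mem_regularSet hB hx)
      (A / ∏ j, B j))).congr fun l => ?_
  rw [term3_eq hB]

theorem newtonCoeff_div_qPoch_succ {A C : ℂ} (hC : ∀ n : ℕ, C * q ^ n ≠ 1) (N : ℕ) :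
    newtonCoeff q A C (N + 1) / qPoch q C (N + 1) * (1 - C * q ^ N)
      = newtonCoeff q A C N / qPoch q C N * (A - C * q ^ N) := by
  have h1 : 1 - C * q ^ N ≠ 0 := sub_ne_zero.mpr (hC N).symm
  rw [newtonCoeff_succ, qPoch_succ]
  field_simp

theorem isSolutionOn_regularSet (hq0 : q ≠ 0) (hq : ‖q‖ < 1) (hB : ∀ i, B i ≠ 0) {A C : ℂ}
    {c : ℕ → ℂ} (hc : ∀ N, c (N + 1) * (1 - C * q ^ N) = c N * (A - C * q ^ N))
    {D : Set (Fin M → ℂ)} (hD : D ⊆ regularSet q B) (hD1 : ∀ x ∈ D, (fun i => q * x i) ∈ D)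
    (hD2 : ∀ x ∈ D, ∀ i, Function.update x i (q * x i) ∈ D) {z : (Fin M → ℂ) → ℂ}
    (hz : ∀ x ∈ D, ∃ s, z x = weight q B x * s ∧
      HasSum (fun N => c N * newtonDiff q N (pochRatio q B fun i => B i * x i) 0) s) :
    IsSolutionOn q A B C D z := by
  refine isSolutionOn_of_hasSum hq0 hq hc hD hD1 hD2 fun x hx => ?_
  obtain ⟨s, hs, h⟩ := hz x hx
  rw [hs]
  refine (h.mul_left (weight q B x)).congr_fun fun N => ?_
  rw [newtonDiff_weightSeq hq hB (hD hx)]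
  ring

theorem isSolutionOn_solution3 (hq0 : q ≠ 0) (hq : ‖q‖ < 1) (hB : ∀ i, B i ≠ 0) {A C : ℂ}
    (hA : A ≠ 0) (hC : ∀ n : ℕ, C * q ^ n ≠ 1) :
    IsSolutionOn q A B C (regularSet q B) (solution3 q A B C) := by
  refine isSolutionOn_regularSet hq0 hq hB (c := fun N => newtonCoeff q A C N / qPoch q C N)
    (newtonCoeff_div_qPoch_succ hC) subset_rfl
    (fun x hx => scale_mem_regularSet hq0 hx) (fun x hx => update_mem_regularSet hq0 hx)
    fun x hx => ⟨_, rfl, ?_⟩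
  have h := milneSum_hasSum_zero_one hq0 hq hB (isGeneric_of_mem_regularSet hB hx)
    (boundedFun_qPoch_div hq hC (C / A)) (L := A)
  simp only [← term3_eq hB] at h
  refine h.congr_fun fun N => ?_
  rw [newtonCoeff_eq hA]
  ring

theorem summable_term2 (hq : ‖q‖ < 1) (hB : ∀ i, B i ≠ 0) {A C : ℂ}
    (hCB : ‖C / ∏ j, B j‖ < 1) (hx : x ∈ regularSet q B) : Summable (term2 q A B C x) :=
  (summable_pow_mul_milneTerm_one (a := B) hq (isGeneric_of_mem_regularSet hB hx) (A / C)
    hCB).congr fun l => by rw [term2_eq hB]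

theorem boundedFun_binomCoeff (hq : ‖q‖ < 1) (c : ℂ) :
    BoundedFun fun p : ℕ × ℕ => binomCoeff q c 1 p.1 p.2 := by
  have h := (boundedFun_qPoch_shift hq c).mul ((boundedFun_inv_qPoch hq (a := q) fun n h =>
    one_sub_pow_ne_zero hq n (by rw [pow_succ', h, sub_self])).comp fun p : ℕ × ℕ => p.2)
  convert h using 2 with p
  simp [binomCoeff, div_eq_mul_inv]

/-- The series `∑_m u^m (c q^k)_m / (q)_m`. -/
noncomputable def binomSeries (q c u : ℂ) (k : ℕ) : ℂ := ∑' m : ℕ, u ^ m * binomCoeff q c 1 k m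

theorem summable_binomSeries (hq : ‖q‖ < 1) (c : ℂ) {u : ℂ} (hu : ‖u‖ < 1) (k : ℕ) :
    Summable fun m : ℕ => u ^ m * binomCoeff q c 1 k m := by
  refine (((boundedFun_binomCoeff hq c).comp fun m => (k, m)).summable_mul
    (summable_geometric_of_norm_lt_one hu)).congr fun m => mul_comm _ _

/-- By the q-binomial theorem the series is (c u q^k)_∞ / (u)_∞, but only the ratio of consecutive
values is needed, and it follows by comparing coefficients. No division by 1 - c u q^k occurs, so C
q^n = 1 is allowed in the second solution. -/
theorem binomSeries_succ (hq : ‖q‖ < 1) (c : ℂ) {u : ℂ} (hu : ‖u‖ < 1) (k : ℕ) :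
    binomSeries q c u (k + 1) * (1 - c * u * q ^ k) = binomSeries q c u k := by
  have hk := summable_binomSeries hq c hu k
  have hk1 := summable_binomSeries hq c hu (k + 1)
  have e : ∀ m, u ^ (m + 1) * binomCoeff q c 1 k (m + 1)
      = u ^ (m + 1) * binomCoeff q c 1 (k + 1) (m + 1)
        - c * u * q ^ k * (u ^ m * binomCoeff q c 1 (k + 1) m) := by
    intro m
    refine mul_left_cancel₀ (one_sub_pow_ne_zero hq m) ?_
    linear_combination u ^ (m + 1) * binomCoeff_succ' hq c 1 k m
      - u ^ (m + 1) * binomCoeff_succ hq c 1 (k + 1) m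
  have h1 : binomSeries q c u k = 1 + ((binomSeries q c u (k + 1) - 1)
      - c * u * q ^ k * binomSeries q c u (k + 1)) := by
    have h0 : binomSeries q c u (k + 1) - 1
        = ∑' m, u ^ (m + 1) * binomCoeff q c 1 (k + 1) (m + 1) := by
      rw [binomSeries, hk1.tsum_eq_zero_add]
      simp
    rw [h0]
    nth_rewrite 1 [binomSeries]
    rw [hk.tsum_eq_zero_add]
    simp only [e]
    rw [Summable.tsum_sub ((summable_nat_add_iff 1).mpr hk1) (hk1.mul_left _), tsum_mul_left]
    simp [binomSeries]
  rw [h1]; ring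

theorem hasSum_sum_antidiagonal {F : ℕ × ℕ → ℂ} (hF : Summable F) :
    HasSum (fun N => ∑ p ∈ Finset.HasAntidiagonal.antidiagonal N, F p) (∑' p, F p) := by
  have h := Finset.HasAntidiagonal.sigmaAntidiagonalEquivProd.hasSum_iff.mpr hF.hasSum
  refine h.sigma fun N => ?_
  exact (Finset.HasAntidiagonal.antidiagonal N).hasSum F

theorem summable_newtonCoeff_mul (hq0 : q ≠ 0) (hq : ‖q‖ < 1) (hB : ∀ i, B i ≠ 0) (A C : ℂ)
    (hx : x ∈ regularSet q B) :
    Summable fun N => newtonCoeff q A C N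
      * newtonDiff q N (pochRatio q B fun i => B i * x i) 0 := by
  obtain ⟨L, hL, hb⟩ := boundedFun_newtonCoeff hq A C
  refine (milneSum_hasSum_zero_one hq0 hq hB (isGeneric_of_mem_regularSet hB hx)
    hb (L := L)).summable.congr fun N => ?_
  field_simp

/-- An interchange of summation. Writing u^N = u^k u^m, the part u^k turns P^k ∏ (A/C - q^i) into ∏
(A - C q^i) because P u = C. The double series converges absolutely since `binomCoeff` is bounded
uniformly in both indices. -/
theorem hasSum_newtonCoeff_mul_binomSeries (hq : ‖q‖ < 1) {A C P u : ℂ} (hC : C ≠ 0)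
    (hCu : P * u = C) (hu : ‖u‖ < 1) {R : ℕ → ℂ} (hR : Summable fun N => newtonCoeff q A C N * R N)
    {S : ℂ} (hS : HasSum (fun N => u ^ N * ∑ p ∈ Finset.HasAntidiagonal.antidiagonal N, R p.1
      * (P ^ p.1 * ∏ i ∈ Finset.range p.1, (A / C - 1 * q ^ i)) * binomCoeff q P 1 p.1 p.2) S) :
    HasSum (fun N => newtonCoeff q A C N * binomSeries q P u N * R N) S := by
  let F : ℕ × ℕ → ℂ := fun p => binomCoeff q P 1 p.1 p.2 * (newtonCoeff q A C p.1 * R p.1 * u ^ p.2)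
  have h0 : Summable fun p : ℕ × ℕ => newtonCoeff q A C p.1 * R p.1 * u ^ p.2 :=
    summable_mul_of_summable_norm (f := fun N => newtonCoeff q A C N * R N) (g := fun m => u ^ m)
      hR.norm (summable_geometric_of_norm_lt_one hu).norm
  have hF : Summable F := (boundedFun_binomCoeff hq P).summable_mul h0
  have h1 := hasSum_sum_antidiagonal hF
  have h3 : ∀ N, ∑ p ∈ Finset.HasAntidiagonal.antidiagonal N, F p
      = u ^ N * ∑ p ∈ Finset.HasAntidiagonal.antidiagonal N, R p.1
        * (P ^ p.1 * ∏ i ∈ Finset.range p.1, (A / C - 1 * q ^ i)) * binomCoeff q P 1 p.1 p.2 := by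
    intro N
    rw [Finset.mul_sum]
    refine Finset.sum_congr rfl fun p hp => ?_
    rw [← Finset.HasAntidiagonal.mem_antidiagonal.mp hp]
    have h5 : newtonCoeff q A C p.1
        = u ^ p.1 * (P ^ p.1 * ∏ i ∈ Finset.range p.1, (A / C - 1 * q ^ i)) := by
      rw [← mul_assoc, ← mul_pow, mul_comm u, hCu, newtonCoeff, Finset.pow_eq_prod_const,
        ← Finset.prod_mul_distrib]
      refine Finset.prod_congr rfl fun i _ => ?_
      field_simp
    simp only [F, h5, pow_add]
    ring
  simp only [h3] at h1
  -- Summed along antidiagonals the double series gives S; summing the rows first now gives the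
  -- asserted series.
  rw [hS.unique h1]
  refine hF.hasSum.prod_fiberwise fun k => ?_
  have h6 := ((summable_binomSeries hq P hu k).hasSum).mul_left (newtonCoeff q A C k * R k)
  rw [show newtonCoeff q A C k * binomSeries q P u k * R k
    = newtonCoeff q A C k * R k * ∑' m, u ^ m * binomCoeff q P 1 k m by
      rw [binomSeries]; ring]
  refine h6.congr_fun fun m => ?_
  simp only [F]
  ring

theorem hasSum_term2 (hq0 : q ≠ 0) (hq : ‖q‖ < 1) (hB : ∀ i, B i ≠ 0) {A C : ℂ}
    (hC : C ≠ 0) (hCB : ‖C / ∏ j, B j‖ < 1) (hx : x ∈ regularSet q B) :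
    HasSum (fun N => newtonCoeff q A C N * binomSeries q (∏ j, B j) (C / ∏ j, B j) N
      * newtonDiff q N (pochRatio q B fun i => B i * x i) 0) (∑' l, term2 q A B C x l) := by
  have hP : ∏ j, B j ≠ 0 := Finset.prod_ne_zero_iff.mpr fun i _ => hB i
  refine hasSum_newtonCoeff_mul_binomSeries hq hC (mul_div_cancel₀ C hP) hCB
    (summable_newtonCoeff_mul hq0 hq hB A C hx) ?_
  refine (hasSum_piAntidiag (summable_term2 hq hB hCB hx)).congr_fun fun N => ?_
  rw [← milneSum_eq hq0 hq hB (isGeneric_of_mem_regularSet hB hx), milneSum, Finset.mul_sum]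
  refine Finset.sum_congr rfl fun l hl => ?_
  rw [term2_eq hB, (Finset.mem_piAntidiag.mp hl).1]

theorem isSolutionOn_solution2 (hq0 : q ≠ 0) (hq : ‖q‖ < 1) (hB : ∀ i, B i ≠ 0) {A C : ℂ}
    (hC : C ≠ 0) (hCB : ‖C / ∏ j, B j‖ < 1) :
    IsSolutionOn q A B C (regularSet q B) (solution2 q A B C) := by
  have hP : ∏ j, B j ≠ 0 := Finset.prod_ne_zero_iff.mpr fun i _ => hB i
  refine isSolutionOn_regularSet hq0 hq hB
    (c := fun N => newtonCoeff q A C N * binomSeries q (∏ j, B j) (C / ∏ j, B j) N)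
    (fun N => ?_) subset_rfl
    (fun x hx => scale_mem_regularSet hq0 hx) (fun x hx => update_mem_regularSet hq0 hx)
    fun x hx => ⟨_, rfl, hasSum_term2 hq0 hq hB hC hCB hx⟩
  have h := binomSeries_succ hq (∏ j, B j) hCB N
  rw [mul_div_cancel₀ _ hP] at h
  rw [newtonCoeff_succ, mul_assoc, h]
  ring

end

section

/-! ### A finite form of the first series -/

variable {M : ℕ} {q : ℂ}

/-- `∏_{i < m} q^(n + i)`. -/
noncomputable def shiftPow (q : ℂ) (n m : ℕ) : ℂ := ∏ i ∈ Finset.range m, q ^ (n + i)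

theorem shiftPow_succ (q : ℂ) (n m : ℕ) :
    shiftPow q n (m + 1) = shiftPow q n m * q ^ (n + m) := Finset.prod_range_succ _ _

theorem shiftPow_ne_zero (hq0 : q ≠ 0) (n m : ℕ) : shiftPow q n m ≠ 0 :=
  Finset.prod_ne_zero_iff.mpr fun _ _ => pow_ne_zero _ hq0

theorem shiftPow_add (q : ℂ) (n m : ℕ) :
    shiftPow q 0 (n + m) = shiftPow q 0 n * shiftPow q n m := by
  simp [shiftPow, Finset.prod_range_add]

theorem shiftPow_zero_left (q : ℂ) (n : ℕ) : shiftPow q 0 n = q ^ n.choose 2 := by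
  induction n with
  | zero => simp [shiftPow]
  | succ n ih =>
    rw [shiftPow_succ, ih, zero_add, Nat.choose_succ_succ' n 1, Nat.choose_one_right, pow_add,
      mul_comm]

theorem shiftPow_mul (q : ℂ) (k m : ℕ) :
    shiftPow q k m * shiftPow q 0 m * q ^ m = (q ^ (k + m)) ^ m := by
  induction m with
  | zero => simp [shiftPow]
  | succ m ih =>
    have h : (q ^ (k + (m + 1))) ^ (m + 1) = (q ^ (k + m)) ^ m * (q ^ (k + m) * q ^ m * q) := by
      ring
    rw [h, ← ih, shiftPow_succ, shiftPow_succ]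
    ring

/-- Reversing the order of the factors and pulling -1/(y q^{n+i}) out of each. This converts
parameters depending on N = n + m into ones that have a limit as m grows. -/
theorem qPoch_reverse (hq0 : q ≠ 0) {y : ℂ} (hy : y ≠ 0) (n m : ℕ) :
    qPoch q (q / (y * q ^ (n + m))) m
      = qPoch q (y * q ^ n) m * (-y⁻¹) ^ m / shiftPow q n m := by
  rw [qPoch, ← Finset.prod_range_reflect, qPoch, shiftPow, Finset.pow_eq_prod_const (-y⁻¹),
    ← Finset.prod_mul_distrib, ← Finset.prod_div_distrib]
  refine Finset.prod_congr rfl fun j hj => ?_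
  obtain ⟨d, rfl⟩ : ∃ d, m = j + 1 + d := ⟨m - (j + 1), by have := Finset.mem_range.mp hj; omega⟩
  rw [show j + 1 + d - 1 - j = d by omega]
  field_simp
  ring

theorem prod_neg_reverse (hq0 : q ≠ 0) {y : ℂ} (hy : y ≠ 0) (n m : ℕ) :
    ∏ i ∈ Finset.range m, (-(q / (y * q ^ (n + m)) * q ^ i)) = (-y⁻¹) ^ m / shiftPow q n m := by
  rw [← Finset.prod_range_reflect, shiftPow, Finset.pow_eq_prod_const (-y⁻¹), ← Finset.prod_div_distrib]
  refine Finset.prod_congr rfl fun j hj => ?_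
  obtain ⟨d, rfl⟩ : ∃ d, m = j + 1 + d := ⟨m - (j + 1), by have := Finset.mem_range.mp hj; omega⟩
  rw [show j + 1 + d - 1 - j = d by omega]
  field_simp
  ring

theorem sum_piAntidiag_cons (N : ℕ) (f : (Fin (M + 1) → ℕ) → ℂ) :
    ∑ l ∈ Finset.piAntidiag Finset.univ N, f l
      = ∑ p ∈ Finset.HasAntidiagonal.antidiagonal N,
        ∑ l ∈ Finset.piAntidiag (Finset.univ : Finset (Fin M)) p.1,
          f (Fin.cons p.2 l : Fin (M + 1) → ℕ) := by
  rw [Finset.sum_sigma']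
  symm
  refine Finset.sum_bij' (fun s _ => (Fin.cons s.1.2 s.2 : Fin (M + 1) → ℕ))
    (fun l _ => ⟨(∑ i, Fin.tail l i, l 0), Fin.tail l⟩) ?_ ?_ ?_ ?_ fun _ _ => rfl
  · rintro ⟨⟨n, m⟩, l⟩ hs
    simp only [Finset.mem_sigma, Finset.HasAntidiagonal.mem_antidiagonal, Finset.mem_piAntidiag,
      Finset.mem_univ, implies_true, and_true] at hs ⊢
    rw [Fin.sum_univ_succ]
    simp only [Fin.cons_zero, Fin.cons_succ]
    have h : ∑ i, l i = n := hs.2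
    omega
  · intro l hl
    simp only [Finset.mem_sigma, Finset.HasAntidiagonal.mem_antidiagonal, Finset.mem_piAntidiag,
      Finset.mem_univ, implies_true, and_true] at hl ⊢
    rw [Fin.sum_univ_succ] at hl
    simp only [Fin.tail]
    omega
  · rintro ⟨⟨n, m⟩, l⟩ hs
    simp only [Finset.mem_sigma, Finset.HasAntidiagonal.mem_antidiagonal, Finset.mem_piAntidiag,
      Finset.mem_univ, implies_true, and_true] at hs
    simp [hs.2]
  · intro l _
    simp

theorem vdm_cons (y0 : ℂ) (y : Fin M → ℂ) :
    vdm (Fin.cons y0 y : Fin (M + 1) → ℂ) = (∏ j, (y0 - y j)) * vdm y := by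
  simp only [vdm, Fin.prod_univ_succ, Fin.cons_zero, Fin.cons_succ]
  congr 1
  · rw [Fin.Ioi_zero_eq_map, Finset.prod_map]
    simp
  · refine Finset.prod_congr rfl fun i _ => ?_
    rw [← Fin.map_succEmb_Ioi, Finset.prod_map]
    simp

/-- Separates the extra variable: the summand in the original variables, the pure factor of X_0, and
the factors coupling X_0 with each X_j. -/
theorem milneTerm_cons {X0 : ℂ} (hX0 : X0 ≠ 0) (a0 : ℂ) (a X : Fin M → ℂ) (m : ℕ)
    (l : Fin M → ℕ) :
    milneTerm q (Fin.cons a0 a) (Fin.cons X0 X : Fin (M + 1) → ℂ) 0 1 (Fin.cons m l)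
      = milneTerm q a X 0 1 l
        * (qPoch q a0 m / qPoch q q m
          * ((∏ k ∈ Finset.range m, (-(X0 * q ^ k))) / qPoch q X0 m))
        * ∏ j, ((X0 * q ^ m - X j * q ^ l j) / (X0 - X j)
          * (qPoch q (a j * X0 / X j) m / qPoch q (q * X0 / X j) m)
          * (qPoch q (a0 * X j / X0) (l j) / qPoch q (q * X j / X0) (l j))) := by
  have hv : (fun i => (Fin.cons X0 X : Fin (M + 1) → ℂ) i * q ^ (Fin.cons m l : Fin (M + 1) → ℕ) i)
      = (Fin.cons (X0 * q ^ m) fun j => X j * q ^ l j : Fin (M + 1) → ℂ) := by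
    funext i
    refine Fin.cases ?_ (fun j => ?_) i <;> simp
  have hs : ∀ i : Fin M, milneFactor q (Fin.cons a0 a) (Fin.cons X0 X : Fin (M + 1) → ℂ) 0 1 i.succ
        (l i)
      = milneFactor q a X 0 1 i (l i)
        * (qPoch q (a0 * X i / X0) (l i) / qPoch q (q * X i / X0) (l i)) := by
    intro i
    simp only [milneFactor, Fin.prod_univ_succ, Fin.cons_zero, Fin.cons_succ, div_eq_mul_inv,
      mul_inv]
    ring
  have h0 : milneFactor q (Fin.cons a0 a) (Fin.cons X0 X : Fin (M + 1) → ℂ) 0 1 0 m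
      = (∏ j, qPoch q (a j * X0 / X j) m / qPoch q (q * X0 / X j) m)
        * (qPoch q a0 m / qPoch q q m
          * ((∏ k ∈ Finset.range m, (-(X0 * q ^ k))) / qPoch q X0 m)) := by
    simp only [milneFactor, Fin.prod_univ_succ, Fin.cons_zero, Fin.cons_succ, zero_sub, one_mul,
      mul_div_cancel_right₀ _ hX0, Finset.prod_div_distrib]
    simp only [div_eq_mul_inv, mul_inv]
    ring
  rw [milneTerm, hv, vdm_cons, vdm_cons, Fin.prod_univ_succ]
  simp only [Fin.cons_zero, Fin.cons_succ, hs, h0, Finset.prod_mul_distrib]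
  rw [milneTerm, mul_div_mul_comm, ← Finset.prod_div_distrib]
  ring

/-- The factor attached to one variable in the summand of the finite form of the first series. -/
noncomputable def wpFactor (q A C b x : ℂ) (n m l : ℕ) : ℂ :=
  (1 - A * (b * x) * q ^ (n + l) / q) * qPoch q (A * x * q ^ n) m * qPoch q (A * (b * x) / C) l
    / qPoch q (A * (b * x) / q * q ^ n) (m + 1 + l)

/-- The coupling factor at X_0 = q/(A q^N), a_0 = q/(C q^N), N = n + m. Three denominator products,
of lengths m, 1 and l, join into one of length m + 1 + l. The powers of A cancel, so the result is
meaningful at A = 0 and continuous in A as long as the denominators do not vanish. -/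
theorem wpFactor_eq (hq0 : q ≠ 0) {A C b x : ℂ} (hA : A ≠ 0) (hC : C ≠ 0) (hb : b ≠ 0)
    (hx : x ≠ 0) (hr : ∀ k : ℕ, A * (b * x) * q ^ k ≠ q) (n m l : ℕ) :
    (q / (A * q ^ (n + m)) * q ^ m - b * x * q ^ l) / (q / (A * q ^ (n + m)) - b * x)
        * (qPoch q (b * (q / (A * q ^ (n + m))) / (b * x)) m
          / qPoch q (q * (q / (A * q ^ (n + m))) / (b * x)) m)
        * (qPoch q (q / (C * q ^ (n + m)) * (b * x) / (q / (A * q ^ (n + m)))) l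
          / qPoch q (q * (b * x) / (q / (A * q ^ (n + m)))) l)
      = b ^ m * wpFactor q A C b x n m l := by
  have hne : ∀ k : ℕ, 1 - A * (b * x) / q * q ^ k ≠ 0 := by
    intro k h
    refine hr k ?_
    field_simp at h
    linear_combination -h
  have e1 : b * (q / (A * q ^ (n + m))) / (b * x) = q / (A * x * q ^ (n + m)) := by
    field_simp
  have e2 : q * (q / (A * q ^ (n + m))) / (b * x) = q / (A * (b * x) / q * q ^ (n + m)) := by
    field_simp
  have e3 : q / (C * q ^ (n + m)) * (b * x) / (q / (A * q ^ (n + m))) = A * (b * x) / C := by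
    field_simp
  have e4 : q * (b * x) / (q / (A * q ^ (n + m))) = A * (b * x) / q * q ^ n * q ^ (m + 1) := by
    field_simp
    ring
  have e5 : (q / (A * q ^ (n + m)) * q ^ m - b * x * q ^ l) / (q / (A * q ^ (n + m)) - b * x)
      = q ^ m * (1 - A * (b * x) * q ^ (n + l) / q)
        / (1 - A * (b * x) / q * q ^ n * q ^ m) := by
    have h1 := hne (n + m)
    have h2 : q / (A * q ^ (n + m)) - b * x ≠ 0 := by
      intro h
      apply h1
      field_simp at h ⊢
      linear_combination h
    rw [mul_assoc _ (q ^ n), ← pow_add, div_eq_div_iff h2 h1]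
    field_simp
    ring
  have e6 : (-(A * x)⁻¹) ^ m * q ^ m = b ^ m * (-(A * (b * x) / q)⁻¹) ^ m := by
    rw [← mul_pow, ← mul_pow]
    congr 1
    field_simp
  rw [e1, e2, e3, e4, e5, qPoch_reverse hq0 (mul_ne_zero hA hx),
    qPoch_reverse hq0 (div_ne_zero (mul_ne_zero hA (mul_ne_zero hb hx)) hq0), wpFactor,
    qPoch_add _ _ (m + 1) l, qPoch_succ]
  have hs := shiftPow_ne_zero hq0 n m
  have hp : (-(A * (b * x) / q)⁻¹) ^ m ≠ 0 := pow_ne_zero _ (neg_ne_zero.mpr (inv_ne_zero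
    (div_ne_zero (mul_ne_zero hA (mul_ne_zero hb hx)) hq0)))
  have h0 : 1 - A * (b * x) / q * q ^ n * q ^ m ≠ 0 := by
    rw [mul_assoc _ (q ^ n), ← pow_add]; exact hne _
  have hd1 : qPoch q (A * (b * x) / q * q ^ n) m ≠ 0 := qPoch_ne_zero (fun k h => by
    rw [mul_assoc, ← pow_add] at h
    exact hne (n + k) (by rw [h, sub_self])) m
  have hd2 : qPoch q (A * (b * x) / q * q ^ n * q ^ (m + 1)) l ≠ 0 := qPoch_ne_zero (fun k h => by
    rw [mul_assoc, mul_assoc, ← pow_add, ← pow_add] at h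
    exact hne _ (by rw [h, sub_self])) l
  generalize qPoch q (A * (b * x) / q * q ^ n * q ^ (m + 1)) l = d2 at *
  generalize qPoch q (A * (b * x) / q * q ^ n) m = d1 at *
  generalize 1 - A * (b * x) / q * q ^ n * q ^ m = d0 at *
  generalize (-(A * (b * x) / q)⁻¹) ^ m = u at *
  generalize (-(A * x)⁻¹) ^ m = v at *
  generalize shiftPow q n m = s at *
  generalize qPoch q (A * x * q ^ n) m = w1
  generalize qPoch q (A * (b * x) / C) l = w2
  generalize 1 - A * (b * x) * q ^ (n + l) / q = w3
  rw [div_div_div_cancel_right₀ hs]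
  rw [show q ^ m * w3 / d0 * (w1 * v / (d1 * u)) * (w2 / d2)
    = (v * q ^ m) * (w1 * w2 * w3) / (d0 * d1 * d2 * u) by field_simp, e6]
  field_simp

/-- The contribution of the extra variable in the Leibniz rule. Moving the base point k into the
parameter Y reduces it to the q-Chu–Vandermonde evaluation `newtonDiff_div`; reversals then restore
parameters free of N. The factor `newtonCoeff` comes from the ratio C/A of the two extra parameters.
-/
theorem newtonDiff_extra (hq0 : q ≠ 0) (hq : ‖q‖ < 1) {A C : ℂ} (hA : A ≠ 0) (hC : C ≠ 0)
    (hA1 : ∀ n m : ℕ, A * q ^ m ≠ q ^ n) (k m : ℕ) :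
    newtonDiff q m (fun n => qPoch q (q / (A * q ^ (k + m)) / (q / (C * q ^ (k + m)))) n
        / qPoch q (q / (A * q ^ (k + m))) n) k
      = newtonCoeff q A C k * qPoch q (C * q ^ k) m / qPoch q q m
        * (shiftPow q 0 (k + m) / qPoch q A (k + m)) * (-1) ^ (k + m) := by
  have hYn : ∀ n : ℕ, q / (A * q ^ (k + m)) * q ^ n ≠ 1 := by
    intro n h
    refine hA1 (n + 1) (k + m) ?_
    field_simp at h
    rw [← h]; ring
  set Y := q / (A * q ^ (k + m)) with hY
  set b := q / (C * q ^ (k + m)) with hb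
  have hY0 : Y ≠ 0 := div_ne_zero hq0 (mul_ne_zero hA (pow_ne_zero _ hq0))
  have hb0 : b ≠ 0 := div_ne_zero hq0 (mul_ne_zero hC (pow_ne_zero _ hq0))
  have hs : (fun n => qPoch q (Y / b) (n + k) / qPoch q Y (n + k))
      = fun n => qPoch q (Y / b) k / qPoch q Y k
        * (qPoch q (Y * q ^ k / b) n / qPoch q (Y * q ^ k) n) := by
    funext n
    rw [add_comm, qPoch_add, qPoch_add, mul_div_mul_comm, div_mul_eq_mul_div Y b]
  have h1 := newtonDiff_shift hq k m (fun n => qPoch q (Y / b) n / qPoch q Y n) 0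
  rw [zero_add, hs, newtonDiff_const_mul] at h1
  have h2 := newtonDiff_div hq0 hq (b := b) (Y := Y * q ^ k) hb0
    (mul_ne_zero hY0 (pow_ne_zero _ hq0))
    (fun n => by rw [mul_assoc, ← pow_add]; exact hYn _) m
  have e1 : Y / b = C / A := by
    rw [hY, hb]; field_simp
  have e2 : Y * q ^ k = q / (A * q ^ (0 + m)) := by
    rw [hY, zero_add, pow_add]; field_simp
  have e3 := qPoch_reverse hq0 hC k m
  have e4 := prod_neg_reverse hq0 hA 0 m
  rw [← hb] at e3
  rw [← e2] at e4
  have e5 := qPoch_reverse hq0 hA 0 (k + m)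
  rw [zero_add, ← hY, pow_zero, mul_one, qPoch_add q Y k m] at e5
  have e6 := shiftPow_mul q k m
  rw [← h1]
  rw [e3, e4] at h2
  have hbm : b ^ m ≠ 0 := pow_ne_zero _ hb0
  refine mul_left_cancel₀ hbm ?_
  rw [mul_left_comm, h2, e1, newtonCoeff_eq hA, hb]
  have n1 := shiftPow_ne_zero hq0 k m
  have n2 := shiftPow_ne_zero hq0 0 m
  have n3 := shiftPow_ne_zero hq0 0 (k + m)
  have n4 : qPoch q A (k + m) ≠ 0 := qPoch_ne_zero (fun n => by simpa using hA1 0 n) _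
  have n5 := qPoch_self_ne_zero hq m
  have n6 : qPoch q Y k ≠ 0 := qPoch_ne_zero hYn k
  have n7 : qPoch q (Y * q ^ k) m ≠ 0 :=
    qPoch_ne_zero (fun n => by rw [mul_assoc, ← pow_add]; exact hYn _) m
  have e7 : qPoch q (Y * q ^ k) m = qPoch q A (k + m) * (-A⁻¹) ^ (k + m)
      / shiftPow q 0 (k + m) / qPoch q Y k := by
    rw [← e5]; field_simp
  rw [e7, div_pow q, mul_pow C, ← e6, inv_eq_one_div, inv_eq_one_div, neg_div', neg_div', div_pow,
    div_pow, div_pow, pow_add (-1 : ℂ), pow_add A]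
  have hm1 : ((-1 : ℂ) ^ m) ≠ 0 := by simp
  have hk1 : ((-1 : ℂ) ^ k) ≠ 0 := by simp
  have hk2 : ((-1 : ℂ) ^ k) * (-1) ^ k = 1 := by rw [← mul_pow]; simp
  generalize ((-1 : ℂ) ^ m) = sm at *
  generalize ((-1 : ℂ) ^ k) = sk at *
  field_simp
  linear_combination (-qPoch q (C / A) k * qPoch q (C * q ^ k) m) * hk2

end

/-! ### The finite identity in M + 1 variables and its extension to all admissible A -/

section

variable {M : ℕ} {q : ℂ} {B x : Fin M → ℂ}

/-- The summand of the finite form of the first series, for `l_1 + ⋯ + l_M = n` and total order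
`n + m`. -/
noncomputable def finiteTerm (q A : ℂ) (B : Fin M → ℂ) (C : ℂ) (x : Fin M → ℂ) (n m : ℕ)
    (l : Fin M → ℕ) : ℂ :=
  milneTerm q B (fun i => B i * x i) 0 1 l
    * (qPoch q A n / (qPoch q C n * qPoch q q m) * (-(C / ∏ j, B j)) ^ n * q ^ n.choose 2)
    * ∏ j, wpFactor q A C (B j) (x j) n m (l j)

theorem isGeneric_cons (hq0 : q ≠ 0) {X : Fin M → ℂ} (hX : IsGeneric q X) {A : ℂ} (hA : A ≠ 0)
    (hA1 : ∀ n m : ℕ, A * q ^ m ≠ q ^ n) (hA2 : ∀ j, ∀ n m : ℕ, A * X j * q ^ m ≠ q ^ n) (N : ℕ) :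
    IsGeneric q (Fin.cons (q / (A * q ^ N)) X : Fin (M + 1) → ℂ) := by
  refine ⟨fun i => ?_, fun i n => ?_, fun i j hij n => ?_⟩
  · refine Fin.cases ?_ (fun i => ?_) i
    · exact div_ne_zero hq0 (mul_ne_zero hA (pow_ne_zero _ hq0))
    · simpa using hX.1 i
  · refine Fin.cases ?_ (fun i => ?_) i
    · intro h
      refine hA1 (n + 1) N ?_
      rw [Fin.cons_zero] at h
      field_simp at h
      rw [← h]; ring
    · simpa using hX.2.1 i n
  · revert hij
    refine Fin.cases ?_ (fun i => ?_) i <;> refine Fin.cases ?_ (fun j => ?_) j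
    · exact fun h => absurd rfl h
    · intro _ h
      refine hA2 j (n + 1) N ?_
      rw [Fin.cons_zero, Fin.cons_succ] at h
      rw [mul_right_comm, mul_comm _ (X j), ← h]
      field_simp
      ring
    · intro _ h
      refine hA2 i 1 (n + N) ?_
      rw [Fin.cons_zero, Fin.cons_succ] at h
      have h2 : A * X i * q ^ (n + N) = X i * q ^ n * (A * q ^ N) := by ring
      rw [h2, h]
      field_simp
    · intro hij h
      simp only [Fin.cons_succ] at h
      exact hX.2.2 i j (fun e => hij (by rw [e])) n h

/-- Both sides evaluate the same Milne sum in M + 1 variables: one splits off the extra summation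
index, the other is `milneSum_zero_one` expanded by the q-Leibniz rule. The hypotheses on A make the
enlarged point generic. -/
theorem sum_finiteTerm_of_generic (hq0 : q ≠ 0) (hq : ‖q‖ < 1) (hB : ∀ i, B i ≠ 0) {A C : ℂ}
    (hC0 : C ≠ 0) (hC : ∀ n : ℕ, C * q ^ n ≠ 1) (hx : x ∈ regularSet q B) (hA : A ≠ 0)
    (hA1 : ∀ n m : ℕ, A * q ^ m ≠ q ^ n) (hA2 : ∀ j, ∀ n m : ℕ, A * (B j * x j) * q ^ m ≠ q ^ n)
    (N : ℕ) :
    ∑ p ∈ Finset.HasAntidiagonal.antidiagonal N, ∑ l ∈ Finset.piAntidiag Finset.univ p.1,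
        finiteTerm q A B C x p.1 p.2 l
      = ∑ p ∈ Finset.HasAntidiagonal.antidiagonal N,
        newtonDiff q p.1 (pochRatio q B fun i => B i * x i) 0
          * (newtonCoeff q A C p.1 / (qPoch q C p.1 * qPoch q q p.2)) := by
  have hX := isGeneric_of_mem_regularSet hB hx
  have hP : ∏ j, B j ≠ 0 := Finset.prod_ne_zero_iff.mpr fun i _ => hB i
  have hN : q ^ N ≠ 0 := pow_ne_zero _ hq0
  have hX0 : q / (A * q ^ N) ≠ 0 := div_ne_zero hq0 (mul_ne_zero hA hN)
  have ha0 : q / (C * q ^ N) ≠ 0 := div_ne_zero hq0 (mul_ne_zero hC0 hN)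
  have hAp : ∀ n, qPoch q A n ≠ 0 := qPoch_ne_zero fun n => by simpa using hA1 0 n
  have hCp : ∀ n, qPoch q C n ≠ 0 := qPoch_ne_zero hC
  have hqp : ∀ n, qPoch q q n ≠ 0 := qPoch_self_ne_zero hq
  have main := milneSum_zero_one hq0 hq (a := (Fin.cons (q / (C * q ^ N)) B : Fin (M + 1) → ℂ))
    (fun i => Fin.cases ha0 (fun i => by simpa using hB i) i)
    (isGeneric_cons hq0 hX hA hA1 hA2 N) N
  -- K collects the factors that depend on N only and are common to both expansions; it is nonzero,
  -- so it can be cancelled at the end.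
  obtain ⟨K, hK⟩ : ∃ K, K = (-(∏ j, B j) / C) ^ N / shiftPow q 0 N
    * (qPoch q C N / qPoch q A N) := ⟨_, rfl⟩
  have hK0 : K ≠ 0 := by
    rw [hK]
    exact mul_ne_zero (div_ne_zero (pow_ne_zero _ (div_ne_zero (neg_ne_zero.mpr hP) hC0))
      (shiftPow_ne_zero hq0 0 N)) (div_ne_zero (hCp N) (hAp N))
  have hL : milneSum q (Fin.cons (q / (C * q ^ N)) B : Fin (M + 1) → ℂ)
        (Fin.cons (q / (A * q ^ N)) fun i => B i * x i : Fin (M + 1) → ℂ) 0 1 N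
      = K * ∑ p ∈ Finset.HasAntidiagonal.antidiagonal N, ∑ l ∈ Finset.piAntidiag Finset.univ p.1,
        finiteTerm q A B C x p.1 p.2 l := by
    rw [milneSum, sum_piAntidiag_cons, Finset.mul_sum]
    refine Finset.sum_congr rfl fun p hp => ?_
    rw [Finset.mul_sum]
    refine Finset.sum_congr rfl fun l _ => ?_
    obtain ⟨n, m⟩ := p
    obtain rfl := Finset.HasAntidiagonal.mem_antidiagonal.mp hp
    rw [milneTerm_cons hX0, finiteTerm]
    have hw : ∀ j, (q / (A * q ^ (n + m)) * q ^ m - B j * x j * q ^ l j)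
          / (q / (A * q ^ (n + m)) - B j * x j)
        * (qPoch q (B j * (q / (A * q ^ (n + m))) / (B j * x j)) m
          / qPoch q (q * (q / (A * q ^ (n + m))) / (B j * x j)) m)
        * (qPoch q (q / (C * q ^ (n + m)) * (B j * x j) / (q / (A * q ^ (n + m)))) (l j)
          / qPoch q (q * (B j * x j) / (q / (A * q ^ (n + m)))) (l j))
        = B j ^ m * wpFactor q A C (B j) (x j) n m (l j) := fun j =>
      wpFactor_eq hq0 hA hC0 (hB j) (hx.1 j)
        (fun k => by simpa only [pow_one] using hA2 j 1 k) n m (l j)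
    simp only [hw, Finset.prod_mul_distrib, Finset.prod_pow]
    rw [qPoch_reverse hq0 hC0, prod_neg_reverse hq0 hA, qPoch_reverse hq0 hA, hK,
      shiftPow_add, ← shiftPow_zero_left, qPoch_add q C n m, qPoch_add q A n m]
    have hA' := hAp (n + m)
    have hC' := hCp (n + m)
    rw [qPoch_add] at hA' hC'
    have h1 := left_ne_zero_of_mul hA'
    have h2 := right_ne_zero_of_mul hA'
    have h3 := left_ne_zero_of_mul hC'
    have h4 := hqp m
    have h5 := shiftPow_ne_zero hq0 n m
    have h6 := shiftPow_ne_zero hq0 0 n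
    have h7 : (-A⁻¹) ^ m ≠ 0 := pow_ne_zero _ (neg_ne_zero.mpr (inv_ne_zero hA))
    have h8 : (-(∏ j, B j) / C) ^ (n + m) * (-(C / ∏ j, B j)) ^ n
        = (-C⁻¹) ^ m * (∏ j, B j) ^ m := by
      rw [pow_add, mul_right_comm, ← mul_pow, ← mul_pow]
      have e1 : -(∏ j, B j) / C * -(C / ∏ j, B j) = 1 := by field_simp
      have e2 : -(∏ j, B j) / C = -C⁻¹ * ∏ j, B j := by field_simp
      rw [e1, e2, one_pow, one_mul]
    generalize (-(∏ j, B j) / C) ^ (n + m) = t1 at *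
    generalize (-(C / ∏ j, B j)) ^ n = t2 at *
    generalize (-C⁻¹) ^ m = t3 at *
    generalize (∏ j, B j) ^ m = t4 at *
    generalize (∏ j, wpFactor q A C (B j) (x j) n m (l j)) = t5 at *
    generalize (-A⁻¹) ^ m = t6 at *
    generalize qPoch q (C * q ^ n) m = t7 at *
    generalize qPoch q (A * q ^ n) m = t8 at *
    field_simp
    linear_combination (-milneTerm q B (fun i => B i * x i) 0 1 l * t7 * t5) * h8
  have hpr : pochRatio q (Fin.cons (q / (C * q ^ N)) B : Fin (M + 1) → ℂ)
        (Fin.cons (q / (A * q ^ N)) fun i => B i * x i : Fin (M + 1) → ℂ)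
      = fun n => pochRatio q B (fun i => B i * x i) n
        * (qPoch q (q / (A * q ^ N) / (q / (C * q ^ N))) n / qPoch q (q / (A * q ^ N)) n) := by
    funext n
    rw [pochRatio, Fin.prod_univ_succ, mul_comm]
    simp [pochRatio]
  have hR : (∏ i, (Fin.cons (q / (C * q ^ N)) B : Fin (M + 1) → ℂ) i) ^ N
        * newtonDiff q N (pochRatio q (Fin.cons (q / (C * q ^ N)) B : Fin (M + 1) → ℂ)
        (Fin.cons (q / (A * q ^ N)) fun i => B i * x i : Fin (M + 1) → ℂ)) 0
      = K * ∑ p ∈ Finset.HasAntidiagonal.antidiagonal N,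
        newtonDiff q p.1 (pochRatio q B fun i => B i * x i) 0
          * (newtonCoeff q A C p.1 / (qPoch q C p.1 * qPoch q q p.2)) := by
    rw [hpr, newtonDiff_mul hq, Finset.mul_sum, Finset.mul_sum]
    refine Finset.sum_congr rfl fun p hp => ?_
    obtain ⟨k, m⟩ := p
    obtain rfl := Finset.HasAntidiagonal.mem_antidiagonal.mp hp
    simp only [zero_add]
    rw [newtonDiff_extra hq0 hq hA hC0 hA1, hK, Fin.prod_univ_succ, qPoch_add q C k m]
    simp only [Fin.cons_zero, Fin.cons_succ]
    have h1 := shiftPow_mul q 0 (k + m)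
    rw [zero_add] at h1
    have h2 := shiftPow_ne_zero hq0 0 (k + m)
    have h3 := hCp k
    have h4 := hqp m
    have h5 := hAp (k + m)
    rw [mul_pow, div_pow q, mul_pow C, ← h1, div_pow, neg_pow (∏ j, B j)]
    field_simp
  rw [hL, hR] at main
  exact mul_left_cancel₀ hK0 main

theorem continuous_qPoch (q : ℂ) {f : ℂ → ℂ} (hf : Continuous f) (n : ℕ) :
    Continuous fun A => qPoch q (f A) n := by
  simp only [qPoch]
  fun_prop

theorem dense_generic (hq0 : q ≠ 0) {X : Fin M → ℂ} (hX : ∀ i, X i ≠ 0) :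
    Dense {A : ℂ | A ≠ 0 ∧ (∀ n m : ℕ, A * q ^ m ≠ q ^ n) ∧
      ∀ j, ∀ n m : ℕ, A * X j * q ^ m ≠ q ^ n} := by
  have hc : (({0} ∪ ⋃ n : ℕ, ⋃ m : ℕ, {q ^ n / q ^ m})
      ∪ ⋃ j, ⋃ n : ℕ, ⋃ m : ℕ, {q ^ n / q ^ m / X j} : Set ℂ).Countable := by
    refine ((Set.countable_singleton _).union ?_).union ?_
    · exact Set.countable_iUnion fun n => Set.countable_iUnion fun m => Set.countable_singleton _
    · exact Set.countable_iUnion fun j => Set.countable_iUnion fun n =>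
        Set.countable_iUnion fun m => Set.countable_singleton _
  refine (hc.dense_compl ℂ).mono fun A hA => ?_
  simp only [Set.mem_compl_iff, Set.mem_union, Set.mem_iUnion, Set.mem_singleton_iff, not_or,
    not_exists] at hA
  refine ⟨hA.1.1, fun n m h => hA.1.2 n m ?_, fun j n m h => hA.2 j n m ?_⟩
  · rw [← h]; field_simp
  · rw [← h]
    have := hX j
    field_simp

/-- Both sides are continuous in A at the given value, and the generic values are dense because only
countably many are excluded. -/
theorem sum_finiteTerm (hq0 : q ≠ 0) (hq : ‖q‖ < 1) (hB : ∀ i, B i ≠ 0) {A C : ℂ}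
    (hC0 : C ≠ 0) (hC : ∀ n : ℕ, C * q ^ n ≠ 1) (hx : x ∈ regularSet q B)
    (hA : ∀ i, ∀ n : ℕ, A * B i * x i * q ^ n ≠ q) (N : ℕ) :
    ∑ p ∈ Finset.HasAntidiagonal.antidiagonal N, ∑ l ∈ Finset.piAntidiag Finset.univ p.1,
        finiteTerm q A B C x p.1 p.2 l
      = ∑ p ∈ Finset.HasAntidiagonal.antidiagonal N,
        newtonDiff q p.1 (pochRatio q B fun i => B i * x i) 0
          * (newtonCoeff q A C p.1 / (qPoch q C p.1 * qPoch q q p.2)) := by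
  have hw : ∀ i n m l, ContinuousAt (fun A => wpFactor q A C (B i) (x i) n m l) A := by
    intro i n m l
    refine ContinuousAt.div (Continuous.continuousAt ?_) (Continuous.continuousAt ?_) ?_
    · have h1 := continuous_qPoch q (f := fun A => A * x i * q ^ n) (by fun_prop) m
      have h2 := continuous_qPoch q (f := fun A => A * (B i * x i) / C) (by fun_prop) l
      fun_prop
    · exact continuous_qPoch q (f := fun A => A * (B i * x i) / q * q ^ n) (by fun_prop) _
    · refine qPoch_ne_zero (fun k h => hA i (n + k) ?_) _
      field_simp at h
      linear_combination h
  have hf : ContinuousAt (fun A => ∑ p ∈ Finset.HasAntidiagonal.antidiagonal N,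
      ∑ l ∈ Finset.piAntidiag Finset.univ p.1, finiteTerm q A B C x p.1 p.2 l) A := by
    refine tendsto_finsetSum _ fun p _ => tendsto_finsetSum _ fun l _ => ?_
    refine ContinuousAt.mul (Continuous.continuousAt ?_)
      (tendsto_finsetProd _ fun j _ => hw j _ _ _)
    have h1 := continuous_qPoch q continuous_id p.1
    simp only [id] at h1
    fun_prop
  have hg : ContinuousAt (fun A => ∑ p ∈ Finset.HasAntidiagonal.antidiagonal N,
      newtonDiff q p.1 (pochRatio q B fun i => B i * x i) 0
        * (newtonCoeff q A C p.1 / (qPoch q C p.1 * qPoch q q p.2))) A := by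
    refine Continuous.continuousAt ?_
    simp only [newtonCoeff]
    fun_prop
  have hd := dense_generic hq0 (X := fun i => B i * x i) (fun i => mul_ne_zero (hB i) (hx.1 i)) A
  have := mem_closure_iff_nhdsWithin_neBot.mp hd
  have hf' := Filter.Tendsto.mono_left hf.tendsto (nhdsWithin_le_nhds (s := {A : ℂ | A ≠ 0 ∧
    (∀ n m : ℕ, A * q ^ m ≠ q ^ n) ∧ ∀ j, ∀ n m : ℕ, A * (B j * x j) * q ^ m ≠ q ^ n}))
  refine tendsto_nhds_unique_of_eventuallyEq hf'
    (Filter.Tendsto.mono_left hg.tendsto nhdsWithin_le_nhds) ?_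
  filter_upwards [self_mem_nhdsWithin] with A' hA'
  exact sum_finiteTerm_of_generic hq0 hq hB hC0 hC hx hA'.1 hA'.2.1 hA'.2.2 N

end

section

/-! ### The first solution -/

variable {M : ℕ} {q : ℂ} {B x : Fin M → ℂ}

theorem one_sub_mul_div_ne {q A b y : ℂ} (hq0 : q ≠ 0) (h : ∀ n : ℕ, A * b * y * q ^ n ≠ q)
    (n : ℕ) : A * (b * y) / q * q ^ n ≠ 1 := by
  intro e
  refine h n ?_
  field_simp at e
  linear_combination e

theorem tendsto_wpFactor (hq0 : q ≠ 0) (hq : ‖q‖ < 1) {A C b y : ℂ}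
    (h : ∀ n : ℕ, A * b * y * q ^ n ≠ q) (n l : ℕ) :
    Filter.Tendsto (fun m => wpFactor q A C b y n m l) Filter.atTop
      (nhds ((1 - A * (b * y) * q ^ (n + l) / q) * qInf q (A * y * q ^ n)
        * qPoch q (A * (b * y) / C) l / qInf q (A * (b * y) / q * q ^ n))) := by
  have h0 : qInf q (A * (b * y) / q * q ^ n) ≠ 0 := qInf_ne_zero hq fun k => by
    rw [mul_assoc, ← pow_add]; exact one_sub_mul_div_ne hq0 h _
  have h1 : Filter.Tendsto (fun m => qPoch q (A * (b * y) / q * q ^ n) (m + 1 + l)) Filter.atTop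
      (nhds (qInf q (A * (b * y) / q * q ^ n))) := by
    refine (tendsto_qPoch hq _).comp ?_
    simpa only [add_assoc] using Filter.tendsto_add_atTop_nat (1 + l)
  exact (((tendsto_qPoch hq _).const_mul _).mul_const _).div h1 h0

theorem boundedFun_wpFactor (hq0 : q ≠ 0) (hq : ‖q‖ < 1) {A C b y : ℂ}
    (h : ∀ n : ℕ, A * b * y * q ^ n ≠ q) :
    BoundedFun fun p : ℕ × ℕ × ℕ => wpFactor q A C b y p.1 p.2.1 p.2.2 := by
  have h1 : BoundedFun fun p : ℕ × ℕ × ℕ => 1 - A * (b * y) / q * q ^ (p.1 + p.2.2) :=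
    (BoundedFun.const 1).sub ((BoundedFun.const _).mul
      ((boundedFun_pow hq).comp fun p : ℕ × ℕ × ℕ => p.1 + p.2.2))
  have h2 := (boundedFun_qPoch_shift hq (A * y)).comp fun p : ℕ × ℕ × ℕ => (p.1, p.2.1)
  have h3 := (boundedFun_qPoch hq (A * (b * y) / C)).comp fun p : ℕ × ℕ × ℕ => p.2.2
  -- The inverse of the shifted factorial (a q^n)_{m+1+l} is written as (a)_n / (a)_{n+m+1+l}, so
  -- that bounds for unshifted factorials suffice.
  have h4 := ((boundedFun_qPoch hq (A * (b * y) / q)).comp fun p : ℕ × ℕ × ℕ => p.1).mul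
    ((boundedFun_inv_qPoch hq (one_sub_mul_div_ne hq0 h)).comp
      fun p : ℕ × ℕ × ℕ => p.1 + (p.2.1 + 1 + p.2.2))
  convert ((h1.mul h2).mul h3).mul h4 using 2 with p
  have h5 : qPoch q (A * (b * y) / q) p.1 ≠ 0 := qPoch_ne_zero (one_sub_mul_div_ne hq0 h) _
  rw [wpFactor, qPoch_add q _ p.1, mul_inv, mul_inv_cancel_left₀ h5, div_eq_mul_inv,
    mul_div_right_comm]

theorem term1_eq (hB : ∀ i, B i ≠ 0) (A C : ℂ) (l : Fin M → ℕ) :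
    term1 q A B C x l = q ^ (∑ i, l i).choose 2 * (qPoch q A (∑ i, l i) / qPoch q C (∑ i, l i))
      * ((-(C / ∏ j, B j)) ^ (∑ i, l i) * milneTerm q B (fun i => B i * x i) 0 1 l)
      * ∏ i, ((1 - A * B i * x i * q ^ ((∑ k, l k) + l i) / q) / (1 - A * B i * x i / q)
        * (qPoch q (A * B i * x i / q) (∑ k, l k) * qPoch q (A * B i * x i / C) (l i)
          / qPoch q (A * x i) (∑ k, l k))) := by
  have h : (-(C / ∏ j, B j)) ^ (∑ i, l i)
      = (-1) ^ (∑ i, l i) * ∏ i, (C / ∏ j, B j) ^ l i := by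
    rw [Finset.prod_pow_eq_pow_sum, ← mul_pow, neg_one_mul]
  have hs : (-1 : ℂ) ^ (∑ i, l i) * (-1) ^ (∑ i, l i) = 1 := by rw [← mul_pow]; simp
  have h2 : (-(C / ∏ j, B j)) ^ (∑ i, l i) * milneTerm q B (fun i => B i * x i) 0 1 l
      = vdm (fun i => B i * x i * q ^ l i) / vdm (fun i => B i * x i)
        * ∏ i, ((∏ j, qPoch q (B i * x i / x j) (l i))
          / ((∏ j, qPoch q (q * (B i * x i) / (B j * x j)) (l i)) * qPoch q (B i * x i) (l i))
          * ((B i * C * x i / ∏ j, B j) ^ l i * q ^ (l i).choose 2)) := by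
    rw [milneTerm_zero_one_eq, milneCore_mul hB, h]
    have h3 : ∀ i, (B i * C * x i / ∏ j, B j) ^ l i * q ^ (l i).choose 2
        = (C / ∏ j, B j) ^ l i * ((B i * x i) ^ l i * q ^ (l i).choose 2) := by
      intro i
      rw [← mul_assoc, ← mul_pow]
      congr 2
      ring
    simp only [h3, Finset.prod_mul_distrib]
    linear_combination (vdm (fun i => B i * x i * q ^ l i) / vdm (fun i => B i * x i)
        * (∏ i, (∏ j, qPoch q (B i * x i / x j) (l i))
          / ((∏ j, qPoch q (q * (B i * x i) / (B j * x j)) (l i)) * qPoch q (B i * x i) (l i)))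
        * (∏ i, (C / ∏ j, B j) ^ l i) * ((∏ i, (B i * x i) ^ l i) * ∏ i, q ^ (l i).choose 2)) * hs
  rw [h2, ← mul_assoc (q ^ _ * _), mul_assoc _ (∏ i, _) (∏ i, _), ← Finset.prod_mul_distrib, term1,
    mul_right_comm (q ^ _)]
  congr 1
  refine Finset.prod_congr rfl fun i _ => ?_
  simp only [div_eq_mul_inv, mul_inv]
  ring

/-- The limit of the summands of the finite form. -/
theorem tendsto_finiteTerm (hq0 : q ≠ 0) (hq : ‖q‖ < 1) (hB : ∀ i, B i ≠ 0) {A C : ℂ}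
    (hA1 : ∀ i, ∀ n : ℕ, A * x i * q ^ n ≠ 1) (hA : ∀ i, ∀ n : ℕ, A * B i * x i * q ^ n ≠ q)
    (l : Fin M → ℕ) :
    Filter.Tendsto (fun m => qPoch q q (∑ i, l i + m) * finiteTerm q A B C x (∑ i, l i) m l)
      Filter.atTop
      (nhds ((∏ i, qInf q (A * x i) / qInf q (A * B i * x i)) * term1 q A B C x l)) := by
  have hqi : qInf q q ≠ 0 := qInf_ne_zero hq fun n h =>
    one_sub_pow_ne_zero hq n (by rw [pow_succ', h, sub_self])
  rw [term1_eq hB]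
  generalize hn : ∑ i, l i = n
  have h1 : Filter.Tendsto (fun m => qPoch q q (n + m) / qPoch q q m) Filter.atTop (nhds 1) := by
    rw [← div_self hqi]
    refine Filter.Tendsto.div ((tendsto_qPoch hq q).comp ?_) (tendsto_qPoch hq q) hqi
    simpa only [add_comm] using Filter.tendsto_add_atTop_nat n
  have h2 := (h1.mul_const (q ^ n.choose 2 * (qPoch q A n / qPoch q C n)
      * ((-(C / ∏ j, B j)) ^ n * milneTerm q B (fun i => B i * x i) 0 1 l))).mul
    (tendsto_finsetProd Finset.univ fun i _ =>
      tendsto_wpFactor (C := C) hq0 hq (hA i) n (l i))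
  -- With (a q^n)_∞ = (a)_∞ / (a)_n, and (a/q)_∞ = (1 - a/q)(a)_∞ for a = A B_i x_i, the limit
  -- separates into the infinite product prefactor and the factor of the summand.
  have h3 : ∀ i, (1 - A * (B i * x i) * q ^ (n + l i) / q) * qInf q (A * x i * q ^ n)
        * qPoch q (A * (B i * x i) / C) (l i) / qInf q (A * (B i * x i) / q * q ^ n)
      = qInf q (A * x i) / qInf q (A * B i * x i)
        * ((1 - A * B i * x i * q ^ (n + l i) / q) / (1 - A * B i * x i / q)
        * (qPoch q (A * B i * x i / q) n * qPoch q (A * B i * x i / C) (l i)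
          / qPoch q (A * x i) n)) := by
    intro i
    have e0 : A * (B i * x i) = A * B i * x i := by ring
    have e1 := qInf_eq_qPoch_mul hq (A * x i) n
    have e2 := qInf_eq_qPoch_mul hq (A * B i * x i / q) n
    have e3 := qInf_eq_mul hq (A * B i * x i / q)
    have n1 : ∀ k : ℕ, A * B i * x i / q * q ^ k ≠ 1 := fun k => by
      simpa only [e0] using one_sub_mul_div_ne hq0 (hA i) k
    have n2 : qInf q (A * B i * x i / q) ≠ 0 := qInf_ne_zero hq n1
    have n3 : qPoch q (A * x i) n ≠ 0 := qPoch_ne_zero (hA1 i) n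
    rw [mul_div_cancel₀ _ hq0] at e3
    have n4 := n2
    rw [e3] at n4
    have n5 := left_ne_zero_of_mul n4
    have n6 := right_ne_zero_of_mul n4
    have n7 := n2
    rw [e2] at n7
    have n8 := left_ne_zero_of_mul n7
    have n9 := right_ne_zero_of_mul n7
    rw [e0, e1, mul_comm (A * x i) (q ^ n), mul_comm (A * B i * x i / q) (q ^ n)]
    have e4 : (qInf q (q ^ n * (A * B i * x i / q)))⁻¹
        = qPoch q (A * B i * x i / q) n
          * ((1 - A * B i * x i / q) * qInf q (A * B i * x i))⁻¹ := by
      rw [← e3, e2]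
      field_simp
    rw [div_eq_mul_inv _ (qInf q (q ^ n * (A * B i * x i / q))), e4, mul_inv]
    field_simp
  simp only [h3, one_mul, Finset.prod_mul_distrib] at h2
  simp only [Finset.prod_mul_distrib]
  refine (h2.congr fun m => ?_).trans_eq ?_
  · rw [finiteTerm]
    simp only [div_eq_mul_inv, mul_inv]
    ring
  · congr 1
    ring

/-- The dominating function for the limit of large order: it does not depend on m and is summable in
l. -/
theorem boundedFun_finiteTerm (hq0 : q ≠ 0) (hq : ‖q‖ < 1) {A C : ℂ}
    (hC : ∀ n : ℕ, C * q ^ n ≠ 1) (hA : ∀ i, ∀ n : ℕ, A * B i * x i * q ^ n ≠ q) :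
    ∃ K : ℝ, ∀ m (l : Fin M → ℕ), ‖qPoch q q (∑ i, l i + m) * finiteTerm q A B C x (∑ i, l i) m l‖
      ≤ K * ‖(-(C / ∏ j, B j)) ^ (∑ i, l i) * milneTerm q B (fun i => B i * x i) 0 1 l‖ := by
  have hqn : ∀ n : ℕ, q * q ^ n ≠ 1 := fun n h =>
    one_sub_pow_ne_zero hq n (by rw [pow_succ', h, sub_self])
  have h1 := (((boundedFun_qPoch hq q).comp fun p : ℕ × (Fin M → ℕ) => ∑ i, p.2 i + p.1).mul
    (((boundedFun_qPoch_div hq hC A).comp fun p : ℕ × (Fin M → ℕ) => ∑ i, p.2 i).mul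
    ((boundedFun_inv_qPoch hq hqn).comp fun p : ℕ × (Fin M → ℕ) => p.1))).mul
    ((boundedFun_pow hq).comp fun p : ℕ × (Fin M → ℕ) => (∑ i, p.2 i).choose 2)
  have h2 : BoundedFun fun p : ℕ × (Fin M → ℕ) =>
      ∏ j, wpFactor q A C (B j) (x j) (∑ i, p.2 i) p.1 (p.2 j) :=
    BoundedFun.prod fun j => (boundedFun_wpFactor hq0 hq (hA j)).comp
      fun p : ℕ × (Fin M → ℕ) => (∑ i, p.2 i, p.1, p.2 j)
  obtain ⟨K, hK⟩ := h1.mul h2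
  refine ⟨K, fun m l => ?_⟩
  refine le_trans (le_of_eq ?_) (mul_le_mul_of_nonneg_right (hK (m, l)) (norm_nonneg _))
  rw [← norm_mul, finiteTerm]
  congr 1
  simp only [div_eq_mul_inv, mul_inv]
  ring

/-- The coefficients (q)_N / (q)_{N-k} are bounded and tend to 1 for fixed k, so dominated
convergence applies. -/
theorem tendsto_sum_antidiagonal (hq : ‖q‖ < 1) {c : ℕ → ℂ} (hc : Summable c) :
    Filter.Tendsto (fun N => qPoch q q N * ∑ p ∈ Finset.HasAntidiagonal.antidiagonal N,
      c p.1 / qPoch q q p.2) Filter.atTop (nhds (∑' k, c k)) := by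
  have hqn : ∀ n : ℕ, q * q ^ n ≠ 1 := fun n h =>
    one_sub_pow_ne_zero hq n (by rw [pow_succ', h, sub_self])
  have hqi : qInf q q ≠ 0 := qInf_ne_zero hq hqn
  obtain ⟨K, hK⟩ := ((boundedFun_qPoch hq q).comp fun p : ℕ × ℕ => p.1).mul
    ((boundedFun_inv_qPoch hq hqn).comp fun p : ℕ × ℕ => p.2)
  have h := tendsto_tsum_of_dominated_convergence (𝓕 := Filter.atTop)
    (f := fun N k => if k ≤ N then qPoch q q N / qPoch q q (N - k) * c k else 0) (g := c)
    (bound := fun k => K * ‖c k‖) (hc.norm.mul_left K) (fun k => ?_)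
    (Filter.Eventually.of_forall fun N k => ?_)
  · refine h.congr fun N => ?_
    rw [Finset.Nat.sum_antidiagonal_eq_sum_range_succ (fun i j => c i / qPoch q q j),
      tsum_eq_sum (s := Finset.range N.succ), Finset.mul_sum]
    · refine Finset.sum_congr rfl fun k hk => ?_
      rw [if_pos (Nat.lt_succ_iff.mp (Finset.mem_range.mp hk))]
      ring
    · intro k hk
      rw [if_neg (fun h => hk (Finset.mem_range.mpr (Nat.lt_succ_iff.mpr h)))]
  · rw [← Filter.tendsto_add_atTop_iff_nat k]
    have h1 : Filter.Tendsto (fun m => qPoch q q (m + k) / qPoch q q m * c k) Filter.atTop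
        (nhds (1 * c k)) := by
      rw [← div_self hqi]
      exact (Filter.Tendsto.div ((tendsto_qPoch hq q).comp (Filter.tendsto_add_atTop_nat k))
        (tendsto_qPoch hq q) hqi).mul_const _
    rw [one_mul] at h1
    refine h1.congr fun m => ?_
    rw [if_pos (Nat.le_add_left k m), Nat.add_sub_cancel]
  · split_ifs
    · rw [norm_mul]
      exact mul_le_mul_of_nonneg_right (hK (N, N - k)) (norm_nonneg _)
    · rw [norm_zero]
      exact mul_nonneg ((norm_nonneg _).trans (hK (0, 0))) (norm_nonneg _)

/-- The finite identity multiplied by (q)_N is passed to the limit on both sides by dominated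
convergence; uniqueness of limits identifies the first series, with its prefactor, as a Newton
series. -/
theorem hasSum_term1 (hq0 : q ≠ 0) (hq : ‖q‖ < 1) (hB : ∀ i, B i ≠ 0) {A C : ℂ}
    (hC0 : C ≠ 0) (hC : ∀ n : ℕ, C * q ^ n ≠ 1) (hx : x ∈ regularSet1 q A B) :
    Summable (term1 q A B C x) ∧
      HasSum (fun N => newtonCoeff q A C N / qPoch q C N
        * newtonDiff q N (pochRatio q B fun i => B i * x i) 0)
        ((∏ i, qInf q (A * x i) / qInf q (A * B i * x i)) * ∑' l, term1 q A B C x l) := by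
  obtain ⟨hx, hA1, hA⟩ := hx
  obtain ⟨K, hK⟩ := boundedFun_finiteTerm (B := B) (x := x) hq0 hq hC hA
  have hsum := ((summable_pow_mul_milneTerm (a := B) hq0 hq (isGeneric_of_mem_regularSet hB hx)
    (-(C / ∏ j, B j))).norm).mul_left K
  have hlim := tendsto_finiteTerm (C := C) hq0 hq hB hA1 hA
  have hP : ∏ i, qInf q (A * x i) / qInf q (A * B i * x i) ≠ 0 := by
    refine Finset.prod_ne_zero_iff.mpr fun i _ => div_ne_zero (qInf_ne_zero hq (hA1 i))
      (qInf_ne_zero hq fun n h => hA i (n + 1) ?_)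
    rw [pow_succ, ← mul_assoc, h, one_mul]
  -- The dominating bound passes to the limit of the finite summands, and the nonzero prefactor is
  -- then removed.
  have hs1 : Summable (term1 q A B C x) := by
    have : Summable fun l => (∏ i, qInf q (A * x i) / qInf q (A * B i * x i))
        * term1 q A B C x l :=
      Summable.of_norm_bounded hsum fun l => le_of_tendsto (hlim l).norm
        (Filter.Eventually.of_forall fun m => hK m l)
    exact (summable_mul_left_iff hP).mp this
  refine ⟨hs1, ?_⟩
  have hc : Summable fun N => newtonCoeff q A C N / qPoch q C N
      * newtonDiff q N (pochRatio q B fun i => B i * x i) 0 :=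
    ((boundedFun_inv_qPoch hq hC).summable_mul
      (summable_newtonCoeff_mul hq0 hq hB A C hx)).congr fun N => by ring
  have t1 := tendsto_sum_antidiagonal hq hc
  -- The finite sum of order N, extended by zero to all l so that it becomes a series over a fixed
  -- index set.
  let f : ℕ → (Fin M → ℕ) → ℂ := fun N l =>
    if ∑ i, l i ≤ N then qPoch q q N * finiteTerm q A B C x (∑ i, l i) (N - ∑ i, l i) l else 0
  have hf : ∀ N l, ‖f N l‖
      ≤ K * ‖(-(C / ∏ j, B j)) ^ (∑ i, l i) * milneTerm q B (fun i => B i * x i) 0 1 l‖ := by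
    intro N l
    simp only [f]
    split_ifs with h
    · have := hK (N - ∑ i, l i) l
      rwa [Nat.add_sub_cancel' h] at this
    · rw [norm_zero]
      exact (norm_nonneg _).trans (hK 0 l)
  have t2 := tendsto_tsum_of_dominated_convergence (𝓕 := Filter.atTop) (f := f) hsum (fun l => by
    rw [← Filter.tendsto_add_atTop_iff_nat (∑ i, l i)]
    refine (hlim l).congr fun m => ?_
    simp only [f]
    rw [if_pos (Nat.le_add_left _ m), Nat.add_sub_cancel, add_comm])
    (Filter.Eventually.of_forall hf)
  rw [tsum_mul_left] at t2
  have e : ∀ N, ∑' l, f N l = qPoch q q N * ∑ p ∈ Finset.HasAntidiagonal.antidiagonal N,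
      (newtonCoeff q A C p.1 / qPoch q C p.1
        * newtonDiff q p.1 (pochRatio q B fun i => B i * x i) 0) / qPoch q q p.2 := by
    intro N
    have h1 := sum_finiteTerm hq0 hq hB hC0 hC hx hA N
    have h2 : ∑ p ∈ Finset.HasAntidiagonal.antidiagonal N,
        (newtonCoeff q A C p.1 / qPoch q C p.1
          * newtonDiff q p.1 (pochRatio q B fun i => B i * x i) 0) / qPoch q q p.2
        = ∑ p ∈ Finset.HasAntidiagonal.antidiagonal N,
          ∑ l ∈ Finset.piAntidiag Finset.univ p.1, finiteTerm q A B C x p.1 p.2 l := by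
      rw [h1]
      refine Finset.sum_congr rfl fun p _ => ?_
      rw [div_mul_eq_div_div]
      ring
    rw [h2, Finset.Nat.sum_antidiagonal_eq_sum_range_succ
      (fun n m => ∑ l ∈ Finset.piAntidiag Finset.univ n, finiteTerm q A B C x n m l),
      Finset.mul_sum]
    have h3 := hasSum_piAntidiag (Summable.of_norm_bounded hsum (hf N))
    rw [← h3.tsum_eq, tsum_eq_sum (s := Finset.range N.succ)]
    · refine Finset.sum_congr rfl fun n hn => ?_
      rw [Finset.mul_sum]
      refine Finset.sum_congr rfl fun l hl => ?_
      have hl' : ∑ i, l i = n := (Finset.mem_piAntidiag.mp hl).1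
      simp only [f]
      rw [hl', if_pos (Nat.lt_succ_iff.mp (Finset.mem_range.mp hn))]
    · intro n hn
      refine Finset.sum_eq_zero fun l hl => ?_
      have hl' : ∑ i, l i = n := (Finset.mem_piAntidiag.mp hl).1
      simp only [f]
      rw [hl', if_neg (fun h => hn (Finset.mem_range.mpr (Nat.lt_succ_iff.mpr h)))]
  simp only [e] at t2
  rw [tendsto_nhds_unique t2 t1]
  exact hc.hasSum

theorem scale_mem_regularSet1 {A : ℂ} (hq0 : q ≠ 0) (hx : x ∈ regularSet1 q A B) :
    (fun i => q * x i) ∈ regularSet1 q A B := by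
  refine ⟨scale_mem_regularSet hq0 hx.1, fun i n => ?_, fun i n => ?_⟩
  · have := hx.2.1 i (n + 1)
    rwa [show A * x i * q ^ (n + 1) = A * (q * x i) * q ^ n by ring] at this
  · have := hx.2.2 i (n + 1)
    rwa [show A * B i * x i * q ^ (n + 1) = A * B i * (q * x i) * q ^ n by ring] at this

theorem update_mem_regularSet1 {A : ℂ} (hq0 : q ≠ 0) (hx : x ∈ regularSet1 q A B) (k : Fin M) :
    Function.update x k (q * x k) ∈ regularSet1 q A B := by
  have hs := scale_mem_regularSet1 hq0 hx
  refine ⟨update_mem_regularSet hq0 hx.1 k, fun i n => ?_, fun i n => ?_⟩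
  · rcases eq_or_ne i k with rfl | h
    · rw [Function.update_self]; exact hs.2.1 i n
    · rw [Function.update_of_ne h]; exact hx.2.1 i n
  · rcases eq_or_ne i k with rfl | h
    · rw [Function.update_self]; exact hs.2.2 i n
    · rw [Function.update_of_ne h]; exact hx.2.2 i n

theorem isSolutionOn_solution1 (hq0 : q ≠ 0) (hq : ‖q‖ < 1) (hB : ∀ i, B i ≠ 0) {A C : ℂ}
    (hC0 : C ≠ 0) (hC : ∀ n : ℕ, C * q ^ n ≠ 1) :
    IsSolutionOn q A B C (regularSet1 q A B) (solution1 q A B C) := by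
  refine isSolutionOn_regularSet hq0 hq hB (c := fun N => newtonCoeff q A C N / qPoch q C N)
    (newtonCoeff_div_qPoch_succ hC) (fun x hx => hx.1)
    (fun x hx => scale_mem_regularSet1 hq0 hx) (fun x hx => update_mem_regularSet1 hq0 hx)
    fun x hx => ⟨_, ?_, (hasSum_term1 hq0 hq hB hC0 hC hx).2⟩
  rw [solution1, weight, ← mul_assoc, ← Finset.prod_mul_distrib]
  congr 1
  exact Finset.prod_congr rfl fun i _ => by rw [div_mul_div_comm, mul_comm (qInf q (B i * x i)),
    mul_comm (qInf q (x i))]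

end

end QAppellLauricella

theorem mainTheorem9 {M : ℕ} (q A : ℂ) (B : Fin M → ℂ) (C : ℂ)
    (hq0 : 0 < ‖q‖) (hq1 : ‖q‖ < 1) (hB : ∀ i, B i ≠ 0) :
    (C ≠ 0 → (∀ n : ℕ, C * q ^ n ≠ 1) →
      (∀ x ∈ QAppellLauricella.regularSet1 q A B,
        Summable (QAppellLauricella.term1 q A B C x)) ∧
      QAppellLauricella.IsSolutionOn q A B C (QAppellLauricella.regularSet1 q A B)
        (QAppellLauricella.solution1 q A B C)) ∧
    (C ≠ 0 → ‖C / ∏ j, B j‖ < 1 →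
      (∀ x ∈ QAppellLauricella.regularSet q B,
        Summable (QAppellLauricella.term2 q A B C x)) ∧
      QAppellLauricella.IsSolutionOn q A B C (QAppellLauricella.regularSet q B)
        (QAppellLauricella.solution2 q A B C)) ∧
    (A ≠ 0 → (∀ n : ℕ, C * q ^ n ≠ 1) →
      (∀ x ∈ QAppellLauricella.regularSet q B,
        Summable (QAppellLauricella.term3 q A B C x)) ∧
      QAppellLauricella.IsSolutionOn q A B C (QAppellLauricella.regularSet q B)
        (QAppellLauricella.solution3 q A B C)) := by
  have hq : q ≠ 0 := norm_pos_iff.mp hq0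
  refine ⟨fun hC0 hC => ⟨fun x hx => ?_, ?_⟩, fun hC0 hCB => ⟨fun x hx => ?_, ?_⟩,
    fun hA hC => ⟨fun x hx => ?_, ?_⟩⟩
  · exact (QAppellLauricella.hasSum_term1 hq hq1 hB hC0 hC hx).1
  · exact QAppellLauricella.isSolutionOn_solution1 hq hq1 hB hC0 hC
  · exact QAppellLauricella.summable_term2 hq1 hB hCB hx
  · exact QAppellLauricella.isSolutionOn_solution2 hq hq1 hB hC0 hCB
  · exact QAppellLauricella.summable_term3 hq hq1 hB hC hx
  · exact QAppellLauricella.isSolutionOn_solution3 hq hq1 hB hA hC
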